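/- Let $M$ be a complex manifold of complex dimension $n\ge 2$, and let $F:T^{1,0}M\to[0,+\infty)$ be a strongly convex complex Finsler metric: $F$ is positive and $C^\infty$ off the zero section, $F(z;\lambda v)=|\lambda|F(z;v)$ for all $\lambda\in\mathbb{C}$, and in the real coordinates $z^\alpha=x^\alpha+ix^{\alpha^*}$, $v^\alpha=y^\alpha+iy^{\alpha^*}$ ($\alpha^*=\alpha+n$) the real fundamental tensor $g_{jk}=\frac12\frac{\partial^2F^2}{\partial y^j\partial y^k}$ is positive definite off the zero section. Let $\hat{\mathbb G}^k=\frac14 g^{kl}\big(\frac{\partial^2F^2}{\partial x^a\partial y^l}y^a-\frac{\partial F^2}{\partial x^l}\big)$ be the spray coefficients, $\hat\Gamma^k_j=\frac{\partial\hat{\mathbb G}^k}{\partial y^j}$, $\frac{\delta}{\delta x^j}=\frac{\partial}{\partial x^j}-\hat\Gamma^k_j\frac{\partial}{\partial y^k}$, $\delta y^l=dy^l+\hat\Gamma^l_m dx^m$, let $\mathcal H_{\mathbb R}$ be the real horizontal bundle spanned by the $\frac{\delta}{\delta x^j}$, and let $\nabla$ be the Cartan connection on the real vertical bundle $\mathcal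 V_{\mathbb R}$, with connection forms $\hat\Gamma^k_{j;l}dx^l+\hat\Gamma^k_{jl}\delta y^l$, where $$\hat\Gamma^k_{j;l}=\frac{g^{ks}}2\Big(\frac{\delta g_{sj}}{\delta x^l}-\frac{\delta g_{jl}}{\delta x^s}+\frac{\delta g_{ls}}{\delta x^j}\Big),\qquad \hat\Gamma^k_{jl}=\frac14 g^{ks}\frac{\partial^3F^2}{\partial y^j\partial y^l\partial y^s}.$$ Let $\mathbf J$ be the canonical complex structure of the complex manifold $T^{1,0}M$. On the complex side let $G_{\alpha\bar\beta}=\frac{\partial^2F^2}{\partial v^\alpha\partial\bar v^\beta}$, let $\Gamma^\alpha_{;\mu}=G^{\bar\tau\alpha}\frac{\partial^2F^2}{\partial z^\mu\partial\bar v^\tau}$, and let $\Gamma^\alpha_{\beta;\mu}=G^{\bar\tau\alpha}\big(\frac{\partial}{\partial z^\mu}-\Gamma^\nu_{;\mu}\frac{\partial}{\partial v^\nu}\big)G_{\beta\bar\tau}$ be the horizontal Chern–Finsler connection coefficients. Suppose that $\nabla_X\mathbf J=0$ for every $X\in\mathcal H_{\mathbb R}$, i.e. $\nabla_X(\mathbf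 JY)=\mathbf J(\nabla_XY)$ for all such $X$ and all smooth vertical vector fields $Y$. Then $F$ is a Kähler–Berwald metric: in all local holomorphic coordinates, $\Gamma^\alpha_{\beta;\mu}=\Gamma^\alpha_{\mu;\beta}$, and $\Gamma^\alpha_{\beta;\mu}$ depends only on the base point $z$. Moreover, off the zero section: (a) $\hat\Gamma^\beta_{\alpha;\gamma}+i\,\hat\Gamma^{\beta^*}_{\alpha;\gamma}=\Gamma^\beta_{\alpha;\gamma}$ for $1\le\alpha,\beta,\gamma\le n$; (b) the horizontal Cartan coefficients coincide with the real Berwald coefficients: $\hat\Gamma^k_{j;l}=\frac{\partial^2\hat{\mathbb G}^k}{\partial y^j\partial y^l}$ for $1\le j,k,l\le 2n$; (c) $F$ is a real Landsberg metric: $\dot A_{jkl}:=A_{jkl|s}\,\frac{y^s}{F}=0$, where $A_{jkl}=\frac F4\frac{\partial^3F^2}{\partial y^j\partial y^k\partial y^l}$ and $|s$ denotes the horizontal covariant derivative (along $\frac{\delta}{\delta x^s}$, with coefficients $\hat\Gamma^k_{j;s}$). -/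

import Mathlib

open scoped ContDiff Manifold

noncomputable section

namespace CFinsler

/-- The model space of an `n`-dimensional complex manifold. -/
abbrev CSpace (n : ℕ) : Type := EuclideanSpace ℂ (Fin n)

/-- Real indices `1, …, 2n`: `Sum.inl α` stands for `α`, and `Sum.inr α` for `α* = α + n`. -/
abbrev RIdx (n : ℕ) : Type := Fin n ⊕ Fin n

variable {n : ℕ}

/-- The real frame of `ℂⁿ` that belongs to `z^α = x^α + i x^{α*}`. -/
def rvec : RIdx n → CSpace n
  | Sum.inl α => EuclideanSpace.single α (1 : ℂ)
  | Sum.inr α => EuclideanSpace.single α Complex.I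

/-- The real coordinates of a vector of `ℂⁿ`. -/
def rcoord (w : CSpace n) : RIdx n → ℝ
  | Sum.inl α => (w α).re
  | Sum.inr α => (w α).im

section PartialDerivatives

/-! Points `p = (z, v)` of `ℂⁿ × ℂⁿ` are induced coordinates on the holomorphic tangent bundle,
with `z^α = x^α + i x^{α*}` and `v^α = y^α + i y^{α*}`. -/

variable {G : Type*} [NormedAddCommGroup G] [NormedSpace ℝ G]

/-- `∂/∂x^j`. -/
def dX (j : RIdx n) (h : CSpace n × CSpace n → G) (p : CSpace n × CSpace n) : G :=
  fderiv ℝ h p (rvec j, 0)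

/-- `∂/∂y^j`. -/
def dY (j : RIdx n) (h : CSpace n × CSpace n → G) (p : CSpace n × CSpace n) : G :=
  fderiv ℝ h p (0, rvec j)

/-- `∂/∂z^α = (∂/∂x^α - i ∂/∂x^{α*}) / 2`. -/
def dZ (α : Fin n) (h : CSpace n × CSpace n → ℂ) (p : CSpace n × CSpace n) : ℂ :=
  (dX (Sum.inl α) h p - Complex.I * dX (Sum.inr α) h p) / 2

/-- `∂/∂v^α = (∂/∂y^α - i ∂/∂y^{α*}) / 2`. -/
def dV (α : Fin n) (h : CSpace n × CSpace n → ℂ) (p : CSpace n × CSpace n) : ℂ :=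
  (dY (Sum.inl α) h p - Complex.I * dY (Sum.inr α) h p) / 2

/-- `∂/∂v̄^α = (∂/∂y^α + i ∂/∂y^{α*}) / 2`. -/
def dVbar (α : Fin n) (h : CSpace n × CSpace n → ℂ) (p : CSpace n × CSpace n) : ℂ :=
  (dY (Sum.inl α) h p + Complex.I * dY (Sum.inr α) h p) / 2

end PartialDerivatives

/-! Below, `f` is the expression of the metric `F` in induced coordinates `(z, v)`. -/

section RealGeometry

variable (f : CSpace n × CSpace n → ℝ)

/-- The real fundamental tensor `g_{jk} = (1/2) ∂²F²/∂y^j∂y^k`. -/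
def fundTensor (p : CSpace n × CSpace n) : Matrix (RIdx n) (RIdx n) ℝ :=
  fun j k => (1 / 2) * dY j (dY k (fun q => f q ^ 2)) p

/-- The geodesic spray coefficients
`𝔾^k = (1/4) g^{kl} (∂²F²/∂x^a∂y^l y^a - ∂F²/∂x^l)`. -/
def spray (k : RIdx n) (p : CSpace n × CSpace n) : ℝ :=
  (1 / 4) * ∑ l, (fundTensor f p)⁻¹ k l *
    ((∑ a, dX a (dY l (fun q => f q ^ 2)) p * rcoord p.2 a) - dX l (fun q => f q ^ 2) p)

/-- The real non-linear connection coefficients `Γ̂^k_j = ∂𝔾^k/∂y^j`. -/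
def nonlin (k j : RIdx n) (p : CSpace n × CSpace n) : ℝ :=
  dY j (spray f k) p

/-- The real Berwald connection coefficients `𝔾^k_{jl} = ∂²𝔾^k/∂y^j∂y^l`. -/
def berwaldCoeff (k j l : RIdx n) (p : CSpace n × CSpace n) : ℝ :=
  dY j (dY l (spray f k)) p

/-- The horizontal vector `δ/δx^j = ∂/∂x^j - Γ̂^k_j ∂/∂y^k`. -/
def horizVec (j : RIdx n) (p : CSpace n × CSpace n) : CSpace n × CSpace n :=
  (rvec j, -∑ k, nonlin f k j p • rvec k)

/-- The derivative of a function along `δ/δx^j`. -/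
def deltaX (j : RIdx n) (h : CSpace n × CSpace n → ℝ) (p : CSpace n × CSpace n) : ℝ :=
  fderiv ℝ h p (horizVec f j p)

/-- The fibre of the real horizontal bundle at `p`. -/
def horizontalSpace (p : CSpace n × CSpace n) : Submodule ℝ (CSpace n × CSpace n) :=
  Submodule.span ℝ (Set.range fun j => horizVec f j p)

/-- The horizontal Cartan connection coefficients
`Γ̂^k_{j;l} = (g^{ks}/2) (δg_{sj}/δx^l - δg_{jl}/δx^s + δg_{ls}/δx^j)`. -/
def cartanHor (k j l : RIdx n) (p : CSpace n × CSpace n) : ℝ :=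
  ∑ s, (fundTensor f p)⁻¹ k s / 2 *
    (deltaX f l (fun q => fundTensor f q s j) p - deltaX f s (fun q => fundTensor f q j l) p
      + deltaX f j (fun q => fundTensor f q l s) p)

/-- The vertical Cartan connection coefficients
`Γ̂^k_{jl} = (1/4) g^{ks} ∂³F²/∂y^j∂y^l∂y^s`. -/
def cartanVer (k j l : RIdx n) (p : CSpace n × CSpace n) : ℝ :=
  (1 / 4) * ∑ s, (fundTensor f p)⁻¹ k s * dY j (dY l (dY s (fun q => f q ^ 2))) p

/-- The covector `δy^l = dy^l + Γ̂^l_m dx^m` on a tangent vector `X` at `p`. -/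
def deltaY (l : RIdx n) (p X : CSpace n × CSpace n) : ℝ :=
  rcoord X.2 l + ∑ m, nonlin f l m p * rcoord X.1 m

/-- The connection form `ω̂_j^k = Γ̂^k_{j;l} dx^l + Γ̂^k_{jl} δy^l` of the Cartan connection, on a
tangent vector `X` at `p`. -/
def cartanForm (j k : RIdx n) (p X : CSpace n × CSpace n) : ℝ :=
  ∑ l, (cartanHor f k j l p * rcoord X.1 l + cartanVer f k j l p * deltaY f l p X)

/-- The Cartan covariant derivative `∇_X Y` at `p` of a vertical vector field
`Y = Y^k ∂/∂y^k` (so that the first component of `Y` vanishes) along a tangent vector `X` at `p`: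
`∇_X Y = (X(Y^k) + Y^j ω̂_j^k(X)) ∂/∂y^k`. -/
def cartanNabla (p X : CSpace n × CSpace n) (Y : CSpace n × CSpace n → CSpace n × CSpace n) :
    CSpace n × CSpace n :=
  (0, fderiv ℝ (fun q => (Y q).2) p X
    + ∑ k, (∑ j, rcoord (Y p).2 j * cartanForm f j k p X) • rvec k)

/-- The Cartan tensor `A_{jkl} = (F/4) ∂³F²/∂y^j∂y^k∂y^l`. -/
def cartanTensor (j k l : RIdx n) (p : CSpace n × CSpace n) : ℝ :=
  f p / 4 * dY j (dY k (dY l (fun q => f q ^ 2))) p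

/-- The Landsberg tensor `Ȧ_{jkl} = A_{jkl|s} y^s / F`, where `|s` is the horizontal covariant
derivative along `δ/δx^s`. -/
def landsbergTensor (j k l : RIdx n) (p : CSpace n × CSpace n) : ℝ :=
  ∑ s, (deltaX f s (cartanTensor f j k l) p
    - ∑ a, (cartanHor f a j s p * cartanTensor f a k l p
      + cartanHor f a k s p * cartanTensor f j a l p
      + cartanHor f a l s p * cartanTensor f j k a p)) * (rcoord p.2 s / f p)

/-- The complexified horizontal Cartan coefficients
`𝒩^β_{α;γ} = Γ̂^β_{α;γ} + i Γ̂^{β*}_{α;γ}`. -/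
def cartanHorC (β α γ : Fin n) (p : CSpace n × CSpace n) : ℂ :=
  (cartanHor f (Sum.inl β) (Sum.inl α) (Sum.inl γ) p : ℂ)
    + Complex.I * (cartanHor f (Sum.inr β) (Sum.inl α) (Sum.inl γ) p : ℂ)

end RealGeometry

/-- The canonical complex structure of the holomorphic tangent bundle on a tangent vector:
`∂/∂x^α ↦ ∂/∂x^{α*}`, `∂/∂x^{α*} ↦ -∂/∂x^α`, and likewise for `∂/∂y^α`, `∂/∂y^{α*}`. -/
def boldJ (w : CSpace n × CSpace n) : CSpace n × CSpace n :=
  (Complex.I • w.1, Complex.I • w.2)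

section ComplexGeometry

variable (f : CSpace n × CSpace n → ℝ)

/-- The complex fundamental tensor `G_{αβ̄} = ∂²F²/∂v^α∂v̄^β`. -/
def cFundTensor (p : CSpace n × CSpace n) : Matrix (Fin n) (Fin n) ℂ :=
  fun α β => dV α (dVbar β (fun q => ((f q ^ 2 : ℝ) : ℂ))) p

/-- The complex non-linear connection coefficients
`Γ^α_{;μ} = G^{τ̄α} ∂²F²/∂z^μ∂v̄^τ` of the Chern-Finsler connection. -/
def cNonlin (α μ : Fin n) (p : CSpace n × CSpace n) : ℂ :=
  ∑ τ, (cFundTensor f p)⁻¹ τ α * dZ μ (dVbar τ (fun q => ((f q ^ 2 : ℝ) : ℂ))) p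

/-- The derivative of a function along `δ_μ = ∂/∂z^μ - Γ^ν_{;μ} ∂/∂v^ν`. -/
def deltaZ (μ : Fin n) (h : CSpace n × CSpace n → ℂ) (p : CSpace n × CSpace n) : ℂ :=
  dZ μ h p - ∑ ν, cNonlin f ν μ p * dV ν h p

/-- The horizontal Chern-Finsler connection coefficients
`Γ^α_{β;μ} = G^{τ̄α} δ_μ(G_{βτ̄})`. -/
def chernFinslerHor (α β μ : Fin n) (p : CSpace n × CSpace n) : ℂ :=
  ∑ τ, (cFundTensor f p)⁻¹ τ α * deltaZ f μ (fun q => cFundTensor f q β τ) p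

end ComplexGeometry

section Manifold

variable {M : Type*} [TopologicalSpace M] [ChartedSpace (CSpace n) M]

/-- A function on the holomorphic tangent bundle, in the coordinates `(z, v)` induced by a
holomorphic chart `φ`. -/
def localExpr (F : TangentBundle 𝓘(ℂ, CSpace n) M → ℝ) (φ : OpenPartialHomeomorph M (CSpace n)) :
    CSpace n × CSpace n → ℝ :=
  fun p => F ⟨φ.symm p.1, mfderiv 𝓘(ℂ, CSpace n) 𝓘(ℂ, CSpace n) φ.symm p.1 p.2⟩

/-- The part of the slit tangent bundle over the domain of `φ`, in induced coordinates. -/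
def slit (φ : OpenPartialHomeomorph M (CSpace n)) : Set (CSpace n × CSpace n) :=
  {p | p.1 ∈ φ.target ∧ p.2 ≠ 0}

/-- Strongly convex complex Finsler metrics on a complex manifold: functions on the holomorphic
tangent bundle that are positive and smooth off the zero section, absolutely homogeneous over `ℂ`,
and whose real fundamental tensor is positive definite off the zero section. -/
structure IsStronglyConvexComplexFinsler (F : TangentBundle 𝓘(ℂ, CSpace n) M → ℝ) : Prop where
  pos : ∀ (x : M) (v : TangentSpace 𝓘(ℂ, CSpace n) x), v ≠ 0 → 0 < F ⟨x, v⟩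
  smooth : ∀ φ ∈ IsManifold.maximalAtlas 𝓘(ℂ, CSpace n) ω M,
    ContDiffOn ℝ ∞ (localExpr F φ) (slit φ)
  homogeneous : ∀ (x : M) (c : ℂ) (v : TangentSpace 𝓘(ℂ, CSpace n) x),
    F ⟨x, c • v⟩ = ‖c‖ * F ⟨x, v⟩
  convex : ∀ φ ∈ IsManifold.maximalAtlas 𝓘(ℂ, CSpace n) ω M, ∀ p ∈ slit φ,
    (fundTensor (localExpr F φ) p).PosDef

/-- `∇_X 𝐉 = 0` for every real horizontal `X`, where `∇` is the Cartan connection, that is,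
`∇_X (𝐉 Y) = 𝐉 (∇_X Y)` for all horizontal `X` and all smooth vertical vector fields `Y`. -/
def HorizontallyParallelJ (F : TangentBundle 𝓘(ℂ, CSpace n) M → ℝ) : Prop :=
  ∀ φ ∈ IsManifold.maximalAtlas 𝓘(ℂ, CSpace n) ω M, ∀ p ∈ slit φ,
    ∀ X ∈ horizontalSpace (localExpr F φ) p,
    ∀ Y : CSpace n × CSpace n → CSpace n × CSpace n,
      ContDiffOn ℝ ∞ Y (slit φ) → (∀ q ∈ slit φ, (Y q).1 = 0) →
      cartanNabla (localExpr F φ) p X (fun q => boldJ (Y q))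
        = boldJ (cartanNabla (localExpr F φ) p X Y)

/-- Kähler-Finsler metrics: `Γ^α_{β;μ} = Γ^α_{μ;β}`. -/
def IsKahlerFinsler (F : TangentBundle 𝓘(ℂ, CSpace n) M → ℝ) : Prop :=
  ∀ φ ∈ IsManifold.maximalAtlas 𝓘(ℂ, CSpace n) ω M, ∀ p ∈ slit φ, ∀ α β μ : Fin n,
    chernFinslerHor (localExpr F φ) α β μ p = chernFinslerHor (localExpr F φ) α μ β p

/-- Complex Berwald metrics: `Γ^α_{β;μ}` depends only on the base point. -/
def IsComplexBerwald (F : TangentBundle 𝓘(ℂ, CSpace n) M → ℝ) : Prop :=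
  ∀ φ ∈ IsManifold.maximalAtlas 𝓘(ℂ, CSpace n) ω M, ∀ p ∈ slit φ, ∀ q ∈ slit φ, p.1 = q.1 →
    ∀ α β μ : Fin n,
      chernFinslerHor (localExpr F φ) α β μ p = chernFinslerHor (localExpr F φ) α β μ q

/-- Kähler-Berwald metrics: both Kähler-Finsler and complex Berwald. -/
def IsKahlerBerwald (F : TangentBundle 𝓘(ℂ, CSpace n) M → ℝ) : Prop :=
  IsKahlerFinsler F ∧ IsComplexBerwald F

/-- Real Landsberg metrics: the Landsberg tensor vanishes. -/
def IsLandsberg (F : TangentBundle 𝓘(ℂ, CSpace n) M → ℝ) : Prop :=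
  ∀ φ ∈ IsManifold.maximalAtlas 𝓘(ℂ, CSpace n) ω M, ∀ p ∈ slit φ, ∀ j k l : RIdx n,
    landsbergTensor (localExpr F φ) j k l p = 0

end Manifold

end CFinsler

end

open scoped ContDiff Manifold

noncomputable section

namespace CFinsler

/-! ### Calculus of iterated Fréchet derivatives on open sets. -/

section Calculus

variable {V W : Type*} [NormedAddCommGroup V] [NormedSpace ℝ V]
  [NormedAddCommGroup W] [NormedSpace ℝ W] {U : Set V} {h : V → W} {p : V}

/-! Write `ℓ = F²`, let `G` be the spray as a fibre-valued map, `N(u) = DG(u)` its vertical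
derivative (the non-linear connection) and `B(w, u) = D²G(w, u)` its second vertical derivative (the
Berwald connection), all in one holomorphic chart.

Tested on constant vertical fields, the hypothesis says that each endomorphism `w ↦ w^j Γ̂^k_{j;l}`
commutes with multiplication by `i`. Contraction with `y^l` turns the Cartan coefficients into `N`,
by Euler's relations, so `N` is complex linear (`nonlin_eq_sum_cartanEnd`, `hasComplexNonlin`). In
other words, `G` is holomorphic along the punctured fibres.

Hence `B` is holomorphic along the fibres too. It is homogeneous of degree zero, so compactness of
the unit sphere bounds it on the whole punctured fibre. On a complex line that misses the origin it
is a bounded entire function, hence constant by Liouville. When `n ≥ 2` such lines join any two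
independent vectors, so `B` depends on the base point only (`spray₂_const`) and the third vertical
derivatives of `G` vanish (`spray₃_eq_zero`). A non-degenerate complex line missing the origin does
not exist for `n = 1`.

The rest follows from one identity: `ℓ` is constant along horizontal vectors (`energy_horizontal`).
Since `B` is vertically constant, vertical differentiation of this identity gives in turn that the
fundamental tensor and the Cartan tensor are horizontally parallel for the connection `B`
(`metric_horizontal`, `cartan_horizontal`). As `B` is symmetric, Koszul's argument identifies the
horizontal Cartan coefficients with `B`, which is (b), and (c) follows.

On the complex side, `G_{αβ̄}` is the sesquilinear part of the vertical Hessian of `ℓ`. Since `B` is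
complex bilinear, its mixed components of type `(1,0)`, `(0,1)` vanish. The same identities then
give that the Chern-Finsler non-linear connection is `N` and its horizontal coefficients are `B`
(`cNonlin_eq`, `chernFinslerHor_eq`). This is (a). Symmetry of `B` is the Kähler condition and its
constancy on fibres the Berwald condition. -/

theorem contDiffOn_fderiv (hU : IsOpen U) (hh : ContDiffOn ℝ ∞ h U) :
    ContDiffOn ℝ ∞ (fderiv ℝ h) U :=
  hh.fderiv_of_isOpen hU (by simp)

theorem hasFDerivAt_of_contDiffOn (hU : IsOpen U) (hh : ContDiffOn ℝ ∞ h U) (hp : p ∈ U) :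
    HasFDerivAt h (fderiv ℝ h p) p :=
  ((hh.contDiffAt (hU.mem_nhds hp)).differentiableAt (by simp)).hasFDerivAt

theorem fderiv_fderiv_swap (hU : IsOpen U) (hh : ContDiffOn ℝ ∞ h U) (hp : p ∈ U) (a b : V) :
    fderiv ℝ (fderiv ℝ h) p a b = fderiv ℝ (fderiv ℝ h) p b a :=
  ((hh.contDiffAt (hU.mem_nhds hp)).isSymmSndFDerivAt (by simpa using ENat.LEInfty.out)) a b

theorem fderiv_apply_eq_of_eqOn {h₁ h₂ : V → W} {h₁' h₂' : V →L[ℝ] W} (hU : IsOpen U)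
    (hp : p ∈ U) (he : ∀ q ∈ U, h₁ q = h₂ q) (h1 : HasFDerivAt h₁ h₁' p)
    (h2 : HasFDerivAt h₂ h₂' p) (s : V) : h₁' s = h₂' s := by
  have : h₁ =ᶠ[nhds p] h₂ := Filter.eventually_of_mem (hU.mem_nhds hp) he
  rw [h1.unique (h2.congr_of_eventuallyEq this)]

/-- The derivative of a contraction of a bilinear form with vector fields. -/
theorem hasFDerivAt_clm_apply₂ {D : V → V →L[ℝ] V →L[ℝ] W} {a b : V → V}
    {D' : V →L[ℝ] V →L[ℝ] V →L[ℝ] W} {a' b' : V →L[ℝ] V}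
    (hD : HasFDerivAt D D' p) (ha : HasFDerivAt a a' p) (hb : HasFDerivAt b b' p) :
    ∃ T : V →L[ℝ] W, HasFDerivAt (fun q => D q (a q) (b q)) T p ∧
      ∀ s, T s = D' s (a p) (b p) + D p (a' s) (b p) + D p (a p) (b' s) := by
  refine ⟨_, (hD.clm_apply ha).clm_apply hb, fun s => ?_⟩
  simp
  abel

theorem hasFDerivAt_clm_apply₁ {D : V → V →L[ℝ] W} {a : V → V}
    {D' : V →L[ℝ] V →L[ℝ] W} {a' : V →L[ℝ] V}
    (hD : HasFDerivAt D D' p) (ha : HasFDerivAt a a' p) :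
    ∃ T : V →L[ℝ] W, HasFDerivAt (fun q => D q (a q)) T p ∧
      ∀ s, T s = D' s (a p) + D p (a' s) := by
  refine ⟨_, hD.clm_apply ha, fun s => ?_⟩
  simp
  abel

theorem fderiv_fderiv_apply (hU : IsOpen U) (hh : ContDiffOn ℝ ∞ h U) (hp : p ∈ U)
    (a b : V) :
    fderiv ℝ (fun q => fderiv ℝ h q a) p b = fderiv ℝ (fderiv ℝ h) p b a := by
  obtain ⟨S, hS, hS'⟩ := hasFDerivAt_clm_apply₁
    (hasFDerivAt_of_contDiffOn hU (contDiffOn_fderiv hU hh) hp) (hasFDerivAt_const a p)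
  rw [hS.fderiv, hS']
  simp

end Calculus

/-! ### Coordinate-free identities for the spray of a homogeneous convex energy. -/

section Spray

set_option maxSynthPendingDepth 10

variable {E : Type*} [NormedAddCommGroup E] [NormedSpace ℝ E]

/-- The inclusion of the fibre directions. -/
abbrev vert : E →L[ℝ] E × E := ContinuousLinearMap.inr ℝ E E

/-- The inclusion of the base directions. -/
abbrev base : E →L[ℝ] E × E := ContinuousLinearMap.inl ℝ E E

theorem vert_snd (u : E) : (vert u).2 = u := rfl

theorem base_snd (u : E) : (base u).2 = 0 := rfl

/-- `G` is the geodesic spray of the energy function `ℓ`, which is homogeneous of degree two and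
strongly convex along the fibres. -/
structure IsSprayOf (U : Set (E × E)) (ℓ : E × E → ℝ) (G : E × E → E) : Prop where
  isOpen : IsOpen U
  smooth : ContDiffOn ℝ ∞ ℓ U
  smooth_spray : ContDiffOn ℝ ∞ G U
  euler : ∀ p ∈ U, fderiv ℝ ℓ p (vert p.2) = 2 * ℓ p
  convex : ∀ p ∈ U, ∀ u : E, u ≠ 0 → 0 < fderiv ℝ (fderiv ℝ ℓ) p (vert u) (vert u)
  spray_eq : ∀ p ∈ U, ∀ t : E, 2 * fderiv ℝ (fderiv ℝ ℓ) p (vert (G p)) (vert t)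
    = fderiv ℝ (fderiv ℝ ℓ) p (base p.2) (vert t) - fderiv ℝ ℓ p (base t)

/-- The horizontal lift of `u` for the non-linear connection of the spray `G`. -/
def hlift (G : E × E → E) (p : E × E) (u : E) : E × E :=
  base u - vert (fderiv ℝ G p (vert u))

namespace IsSprayOf

variable {U : Set (E × E)} {ℓ : E × E → ℝ} {G : E × E → E} {p : E × E}

theorem smooth₁ (H : IsSprayOf U ℓ G) : ContDiffOn ℝ ∞ (fderiv ℝ ℓ) U :=
  contDiffOn_fderiv H.isOpen H.smooth

theorem smooth₂ (H : IsSprayOf U ℓ G) : ContDiffOn ℝ ∞ (fderiv ℝ (fderiv ℝ ℓ)) U :=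
  contDiffOn_fderiv H.isOpen H.smooth₁

theorem smooth₃ (H : IsSprayOf U ℓ G) : ContDiffOn ℝ ∞ (fderiv ℝ (fderiv ℝ (fderiv ℝ ℓ))) U :=
  contDiffOn_fderiv H.isOpen H.smooth₂

theorem hasFDerivAt₁ (H : IsSprayOf U ℓ G) (hp : p ∈ U) :
    HasFDerivAt (fderiv ℝ ℓ) (fderiv ℝ (fderiv ℝ ℓ) p) p :=
  hasFDerivAt_of_contDiffOn H.isOpen H.smooth₁ hp

theorem hasFDerivAt₂ (H : IsSprayOf U ℓ G) (hp : p ∈ U) :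
    HasFDerivAt (fderiv ℝ (fderiv ℝ ℓ)) (fderiv ℝ (fderiv ℝ (fderiv ℝ ℓ)) p) p :=
  hasFDerivAt_of_contDiffOn H.isOpen H.smooth₂ hp

theorem hasFDerivAt₃ (H : IsSprayOf U ℓ G) (hp : p ∈ U) :
    HasFDerivAt (fderiv ℝ (fderiv ℝ (fderiv ℝ ℓ)))
      (fderiv ℝ (fderiv ℝ (fderiv ℝ (fderiv ℝ ℓ))) p) p :=
  hasFDerivAt_of_contDiffOn H.isOpen H.smooth₃ hp

theorem hasFDerivAt_spray (H : IsSprayOf U ℓ G) (hp : p ∈ U) :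
    HasFDerivAt G (fderiv ℝ G p) p :=
  hasFDerivAt_of_contDiffOn H.isOpen H.smooth_spray hp

theorem hasFDerivAt_spray₁ (H : IsSprayOf U ℓ G) (hp : p ∈ U) :
    HasFDerivAt (fderiv ℝ G) (fderiv ℝ (fderiv ℝ G) p) p :=
  hasFDerivAt_of_contDiffOn H.isOpen (contDiffOn_fderiv H.isOpen H.smooth_spray) hp

theorem smooth_spray₂ (H : IsSprayOf U ℓ G) : ContDiffOn ℝ ∞ (fderiv ℝ (fderiv ℝ G)) U :=
  contDiffOn_fderiv H.isOpen (contDiffOn_fderiv H.isOpen H.smooth_spray)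

theorem hasFDerivAt_spray₂ (H : IsSprayOf U ℓ G) (hp : p ∈ U) :
    HasFDerivAt (fderiv ℝ (fderiv ℝ G)) (fderiv ℝ (fderiv ℝ (fderiv ℝ G)) p) p :=
  hasFDerivAt_of_contDiffOn H.isOpen H.smooth_spray₂ hp

theorem swap₂ (H : IsSprayOf U ℓ G) (hp : p ∈ U) (a b : E × E) :
    fderiv ℝ (fderiv ℝ ℓ) p a b = fderiv ℝ (fderiv ℝ ℓ) p b a :=
  fderiv_fderiv_swap H.isOpen H.smooth hp a b

theorem swap₃ (H : IsSprayOf U ℓ G) (hp : p ∈ U) (a b c : E × E) :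
    fderiv ℝ (fderiv ℝ (fderiv ℝ ℓ)) p a b c = fderiv ℝ (fderiv ℝ (fderiv ℝ ℓ)) p b a c := by
  rw [fderiv_fderiv_swap H.isOpen H.smooth₁ hp a b]

theorem swap₃' (H : IsSprayOf U ℓ G) (hp : p ∈ U) (a b c : E × E) :
    fderiv ℝ (fderiv ℝ (fderiv ℝ ℓ)) p a b c = fderiv ℝ (fderiv ℝ (fderiv ℝ ℓ)) p a c b := by
  obtain ⟨S, hS, hS'⟩ := hasFDerivAt_clm_apply₂ (H.hasFDerivAt₂ hp)
    (hasFDerivAt_const b p) (hasFDerivAt_const c p)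
  obtain ⟨T, hT, hT'⟩ := hasFDerivAt_clm_apply₂ (H.hasFDerivAt₂ hp)
    (hasFDerivAt_const c p) (hasFDerivAt_const b p)
  have := fderiv_apply_eq_of_eqOn H.isOpen hp (fun q hq => H.swap₂ hq b c) hS hT a
  rw [hS', hT'] at this
  simpa using this

theorem swap₄ (H : IsSprayOf U ℓ G) (hp : p ∈ U) (a b c d : E × E) :
    fderiv ℝ (fderiv ℝ (fderiv ℝ (fderiv ℝ ℓ))) p a b c d
      = fderiv ℝ (fderiv ℝ (fderiv ℝ (fderiv ℝ ℓ))) p b a c d := by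
  rw [fderiv_fderiv_swap H.isOpen H.smooth₂ hp a b]

theorem spray_swap (H : IsSprayOf U ℓ G) (hp : p ∈ U) (a b : E × E) :
    fderiv ℝ (fderiv ℝ G) p a b = fderiv ℝ (fderiv ℝ G) p b a :=
  fderiv_fderiv_swap H.isOpen H.smooth_spray hp a b

theorem hasFDerivAt_vert_snd (p : E × E) :
    HasFDerivAt (fun q : E × E => vert q.2) (vert.comp (ContinuousLinearMap.snd ℝ E E)) p :=
  (vert.comp (ContinuousLinearMap.snd ℝ E E)).hasFDerivAt

theorem hasFDerivAt_base_snd (p : E × E) :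
    HasFDerivAt (fun q : E × E => base q.2) (base.comp (ContinuousLinearMap.snd ℝ E E)) p :=
  (base.comp (ContinuousLinearMap.snd ℝ E E)).hasFDerivAt

theorem euler₂ (H : IsSprayOf U ℓ G) (hp : p ∈ U) (s : E × E) :
    fderiv ℝ (fderiv ℝ ℓ) p s (vert p.2) + fderiv ℝ ℓ p (vert s.2) = 2 * fderiv ℝ ℓ p s := by
  obtain ⟨S, hS, hS'⟩ := hasFDerivAt_clm_apply₁ (H.hasFDerivAt₁ hp) (hasFDerivAt_vert_snd p)
  have := fderiv_apply_eq_of_eqOn H.isOpen hp H.euler hS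
    ((hasFDerivAt_of_contDiffOn H.isOpen H.smooth hp).const_mul 2) s
  rw [hS'] at this
  simpa using this

theorem euler₃ (H : IsSprayOf U ℓ G) (hp : p ∈ U) (r s : E × E) :
    fderiv ℝ (fderiv ℝ (fderiv ℝ ℓ)) p r s (vert p.2) + fderiv ℝ (fderiv ℝ ℓ) p s (vert r.2)
      + fderiv ℝ (fderiv ℝ ℓ) p r (vert s.2) = 2 * fderiv ℝ (fderiv ℝ ℓ) p r s := by
  obtain ⟨S, hS, hS'⟩ := hasFDerivAt_clm_apply₂ (H.hasFDerivAt₂ hp) (hasFDerivAt_const s p)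
    (hasFDerivAt_vert_snd p)
  obtain ⟨T, hT, hT'⟩ := hasFDerivAt_clm_apply₁ (H.hasFDerivAt₁ hp)
    (hasFDerivAt_const (vert s.2) p)
  obtain ⟨R, hR, hR'⟩ := hasFDerivAt_clm_apply₁ (H.hasFDerivAt₁ hp) (hasFDerivAt_const s p)
  have := fderiv_apply_eq_of_eqOn H.isOpen hp (fun q hq => H.euler₂ hq s) (hS.add hT)
    (hR.const_mul 2) r
  simp only [add_apply, smul_apply, hS', hT', hR'] at this
  simpa using this

/-- Strong convexity makes the vertical Hessian non-degenerate, so identities between fibre vectors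
can be tested by pairing. -/
theorem vert_eq_of_forall (H : IsSprayOf U ℓ G) (hp : p ∈ U) {a b : E}
    (h : ∀ t : E, fderiv ℝ (fderiv ℝ ℓ) p (vert a) (vert t)
      = fderiv ℝ (fderiv ℝ ℓ) p (vert b) (vert t)) : a = b := by
  by_contra hab
  have := H.convex p hp (a - b) (sub_ne_zero.2 hab)
  rw [map_sub vert a b] at this
  simp only [map_sub, sub_apply] at this
  linarith [h a, h b]

theorem spray_eq_deriv (H : IsSprayOf U ℓ G) (hp : p ∈ U) (w t : E) :
    2 * (fderiv ℝ (fderiv ℝ (fderiv ℝ ℓ)) p (vert w) (vert (G p)) (vert t)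
      + fderiv ℝ (fderiv ℝ ℓ) p (vert (fderiv ℝ G p (vert w))) (vert t))
    = fderiv ℝ (fderiv ℝ (fderiv ℝ ℓ)) p (vert w) (base p.2) (vert t)
      + fderiv ℝ (fderiv ℝ ℓ) p (base w) (vert t)
      - fderiv ℝ (fderiv ℝ ℓ) p (vert w) (base t) := by
  have hG : HasFDerivAt (fun q => vert (G q)) (vert.comp (fderiv ℝ G p)) p :=
    (vert (E := E)).hasFDerivAt.comp p (H.hasFDerivAt_spray hp)
  obtain ⟨S, hS, hS'⟩ := hasFDerivAt_clm_apply₂ (H.hasFDerivAt₂ hp) hG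
    (hasFDerivAt_const (vert t) p)
  obtain ⟨T, hT, hT'⟩ := hasFDerivAt_clm_apply₂ (H.hasFDerivAt₂ hp) (hasFDerivAt_base_snd p)
    (hasFDerivAt_const (vert t) p)
  obtain ⟨R, hR, hR'⟩ := hasFDerivAt_clm_apply₁ (H.hasFDerivAt₁ hp) (hasFDerivAt_const (base t) p)
  have := fderiv_apply_eq_of_eqOn H.isOpen hp (fun q hq => H.spray_eq q hq t) (hS.const_mul 2)
    (hT.sub hR) (vert w)
  simp only [sub_apply, smul_apply, hS', hT', hR'] at this
  simpa using this

/-- Euler's relation for the spray, which has degree two. It comes from differentiating the spray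
equation in the radial direction: `D³ℓ(v, G, t)` drops out, and the right-hand side is homogeneous
of degree one in `v` for fixed `t`, against degree zero for the vertical Hessian. -/
theorem nonlin_radial (H : IsSprayOf U ℓ G) (hp : p ∈ U) :
    fderiv ℝ G p (vert p.2) = (2 : ℝ) • G p := by
  refine H.vert_eq_of_forall hp fun t => ?_
  have h1 := H.spray_eq_deriv hp p.2 t
  have h2 := H.euler₃ hp (base p.2) (vert t)
  have h3 := H.euler₃ hp (vert (G p)) (vert t)
  have h4 := H.euler₂ hp (base t)
  have h5 := H.spray_eq p hp t
  rw [H.swap₃' hp, H.swap₃ hp, H.swap₃' hp] at h2 h3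
  rw [H.swap₂ hp (vert p.2) (base t)] at h1
  have h6 := H.swap₂ hp (vert (G p)) (vert t)
  have h7 := H.swap₃' hp (vert p.2) (vert (G p)) (vert t)
  have h8 := H.swap₃' hp (vert p.2) (base p.2) (vert t)
  rw [map_smul, map_smul]
  simp only [vert_snd, base_snd, map_zero, smul_apply, smul_eq_mul] at h1 h2 h3 h4 h5 h6 ⊢
  linarith

/-- The vertical derivative of the spray equation. The terms in `base p.2` and `G p` combine into
the horizontal lift of the radial vector, because that lift is `base p.2 - 2 • vert (G p)`. -/
theorem nonlin_eq (H : IsSprayOf U ℓ G) (hp : p ∈ U) (w t : E) :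
    2 * fderiv ℝ (fderiv ℝ ℓ) p (vert (fderiv ℝ G p (vert w))) (vert t)
      = fderiv ℝ (fderiv ℝ (fderiv ℝ ℓ)) p (hlift G p p.2) (vert w) (vert t)
        + fderiv ℝ (fderiv ℝ ℓ) p (base w) (vert t)
        - fderiv ℝ (fderiv ℝ ℓ) p (base t) (vert w) := by
  have h1 := H.spray_eq_deriv hp w t
  rw [hlift, H.nonlin_radial hp, map_sub, map_smul, map_smul]
  rw [H.swap₃ hp, H.swap₃ hp (vert w), H.swap₂ hp (vert w)] at h1
  simp only [sub_apply, smul_apply, smul_eq_mul]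
  linarith

/-- The energy function is constant along horizontal vectors. -/
theorem energy_horizontal (H : IsSprayOf U ℓ G) (hp : p ∈ U) (u : E) :
    fderiv ℝ ℓ p (hlift G p u) = 0 := by
  -- With `t` radial in the formula for `N`, the Euler relations reduce every term to first
  -- derivatives of `ℓ`.
  have h1 := H.nonlin_eq hp u p.2
  have h2 := H.euler₃ hp (hlift G p p.2) (vert u)
  have h3 := H.euler₂ hp (base u)
  have h4 := H.euler₂ hp (vert (fderiv ℝ G p (vert u)))
  have h5 := H.swap₂ hp (vert u) (vert (fderiv ℝ G p (vert p.2)))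
  simp only [hlift, map_sub, sub_apply, Prod.snd_sub, vert_snd, base_snd, map_zero, zero_sub,
    map_neg] at h1 h2 h3 h4 h5 ⊢
  linarith

theorem radial_horizontal (H : IsSprayOf U ℓ G) (hp : p ∈ U) (u t : E) :
    fderiv ℝ (fderiv ℝ (fderiv ℝ ℓ)) p (hlift G p u) (vert t) (vert p.2)
      = fderiv ℝ (fderiv ℝ ℓ) p (base u) (vert t) := by
  have h2 := H.euler₃ hp (hlift G p u) (vert t)
  have h5 := H.swap₂ hp (vert t) (vert (fderiv ℝ G p (vert u)))
  simp only [hlift, map_sub, sub_apply, Prod.snd_sub, vert_snd, base_snd, zero_sub,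
    map_neg] at h2 h5 ⊢
  linarith

/-- The Koszul expression that defines the horizontal Cartan coefficients, with the radial vector
in one slot, gives back the non-linear connection. -/
theorem koszul_radial (H : IsSprayOf U ℓ G) (hp : p ∈ U) (u t : E) :
    fderiv ℝ (fderiv ℝ (fderiv ℝ ℓ)) p (hlift G p p.2) (vert t) (vert u)
      - fderiv ℝ (fderiv ℝ (fderiv ℝ ℓ)) p (hlift G p t) (vert u) (vert p.2)
      + fderiv ℝ (fderiv ℝ (fderiv ℝ ℓ)) p (hlift G p u) (vert p.2) (vert t)
    = 2 * fderiv ℝ (fderiv ℝ ℓ) p (vert (fderiv ℝ G p (vert u))) (vert t) := by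
  rw [H.nonlin_eq hp, H.radial_horizontal hp, H.swap₃' hp _ (vert p.2), H.radial_horizontal hp,
    H.swap₃' hp _ (vert t)]
  ring

theorem spray₂_radial (H : IsSprayOf U ℓ G) (hp : p ∈ U) (w : E) :
    fderiv ℝ (fderiv ℝ G) p (vert w) (vert p.2) = fderiv ℝ G p (vert w) := by
  obtain ⟨S, hS, hS'⟩ := hasFDerivAt_clm_apply₁ (H.hasFDerivAt_spray₁ hp) (hasFDerivAt_vert_snd p)
  have := fderiv_apply_eq_of_eqOn H.isOpen hp (fun q hq => H.nonlin_radial hq) hS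
    ((H.hasFDerivAt_spray hp).const_smul (2 : ℝ)) (vert w)
  rw [hS', smul_apply, two_smul] at this
  simpa using this

theorem hasFDerivAt_apply₂ {W : Type*} [NormedAddCommGroup W] [NormedSpace ℝ W]
    {D : E × E → E × E →L[ℝ] E × E →L[ℝ] W} {D' : E × E →L[ℝ] E × E →L[ℝ] E × E →L[ℝ] W}
    (hD : HasFDerivAt D D' p) (a b : E × E) :
    ∃ T : E × E →L[ℝ] W, HasFDerivAt (fun q => D q a b) T p ∧ ∀ s, T s = D' s a b := by
  obtain ⟨T, hT, hT'⟩ := hasFDerivAt_clm_apply₂ hD (hasFDerivAt_const a p) (hasFDerivAt_const b p)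
  exact ⟨T, hT, fun s => by simp [hT']⟩

/-- Infinitesimal form of the degree-zero homogeneity of the second vertical derivatives, obtained
by differentiating `spray₂_radial` once more. -/
theorem spray₃_radial (H : IsSprayOf U ℓ G) (hp : p ∈ U) (s w : E) :
    fderiv ℝ (fderiv ℝ (fderiv ℝ G)) p (vert p.2) (vert s) (vert w) = 0 := by
  obtain ⟨S, hS, hS'⟩ := hasFDerivAt_clm_apply₂ (H.hasFDerivAt_spray₂ hp)
    (hasFDerivAt_const (vert w) p) (hasFDerivAt_vert_snd p)
  obtain ⟨T, hT, hT'⟩ := hasFDerivAt_clm_apply₁ (H.hasFDerivAt_spray₁ hp)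
    (hasFDerivAt_const (vert w) p)
  have h1 := fderiv_apply_eq_of_eqOn H.isOpen hp (fun q hq => H.spray₂_radial hq w) hS hT (vert s)
  obtain ⟨S', hS1, hS2⟩ := hasFDerivAt_apply₂ (H.hasFDerivAt_spray₂ hp) (vert w) (vert p.2)
  obtain ⟨T', hT1, hT2⟩ := hasFDerivAt_apply₂ (H.hasFDerivAt_spray₂ hp) (vert p.2) (vert w)
  have h2 := fderiv_apply_eq_of_eqOn H.isOpen hp
    (fun q hq => H.spray_swap hq (vert w) (vert p.2)) hS1 hT1 (vert s)
  rw [hS2, hT2] at h2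
  rw [hS', hT', h2, fderiv_fderiv_swap H.isOpen
    (contDiffOn_fderiv H.isOpen H.smooth_spray) hp (vert s) (vert p.2),
    H.spray_swap hp (vert w)] at h1
  simpa using h1

end IsSprayOf
end Spray

/-! ### Fibrewise holomorphy of the spray, Liouville's theorem, and the Berwald identities. -/

section Holomorphic

set_option maxSynthPendingDepth 10

variable {n : ℕ}

/-- The part of `T × ℂⁿ` off the zero section. -/
def slitOver (T : Set (CSpace n)) : Set (CSpace n × CSpace n) := {p | p.1 ∈ T ∧ p.2 ≠ 0}

/-- The non-linear connection of the spray `G` is complex linear. -/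
def HasComplexNonlin (U : Set (CSpace n × CSpace n)) (G : CSpace n × CSpace n → CSpace n) : Prop :=
  ∀ p ∈ U, ∀ u : CSpace n,
    fderiv ℝ G p (vert (Complex.I • u)) = Complex.I • fderiv ℝ G p (vert u)

/-- The third vertical derivatives of the spray vanish. -/
def IsQuadratic (U : Set (CSpace n × CSpace n)) (G : CSpace n × CSpace n → CSpace n) : Prop :=
  ∀ p ∈ U, ∀ r s w : CSpace n,
    fderiv ℝ (fderiv ℝ (fderiv ℝ G)) p (vert r) (vert s) (vert w) = 0

namespace IsSprayOf

variable {U : Set (CSpace n × CSpace n)} {ℓ : CSpace n × CSpace n → ℝ}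
  {G : CSpace n × CSpace n → CSpace n} {p : CSpace n × CSpace n}

theorem spray₃_swap (H : IsSprayOf U ℓ G) (hp : p ∈ U) (a b c : CSpace n × CSpace n) :
    fderiv ℝ (fderiv ℝ (fderiv ℝ G)) p a b c = fderiv ℝ (fderiv ℝ (fderiv ℝ G)) p b a c := by
  rw [fderiv_fderiv_swap H.isOpen (contDiffOn_fderiv H.isOpen H.smooth_spray) hp a b]

theorem spray₃_swap' (H : IsSprayOf U ℓ G) (hp : p ∈ U) (a b c : CSpace n × CSpace n) :
    fderiv ℝ (fderiv ℝ (fderiv ℝ G)) p a b c = fderiv ℝ (fderiv ℝ (fderiv ℝ G)) p a c b := by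
  obtain ⟨S, hS, hS'⟩ := hasFDerivAt_apply₂ (H.hasFDerivAt_spray₂ hp) b c
  obtain ⟨T, hT, hT'⟩ := hasFDerivAt_apply₂ (H.hasFDerivAt_spray₂ hp) c b
  rw [← hS', ← hT']
  exact fderiv_apply_eq_of_eqOn H.isOpen hp (fun q hq => H.spray_swap hq b c) hS hT a

theorem spray₂_I (H : IsSprayOf U ℓ G) (hN : HasComplexNonlin U G) (hp : p ∈ U)
    (a : CSpace n × CSpace n) (u : CSpace n) :
    fderiv ℝ (fderiv ℝ G) p a (vert (Complex.I • u))
      = Complex.I • fderiv ℝ (fderiv ℝ G) p a (vert u) := by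
  obtain ⟨S, hS, hS'⟩ := hasFDerivAt_clm_apply₁ (H.hasFDerivAt_spray₁ hp)
    (hasFDerivAt_const (vert (Complex.I • u)) p)
  obtain ⟨T, hT, hT'⟩ := hasFDerivAt_clm_apply₁ (H.hasFDerivAt_spray₁ hp)
    (hasFDerivAt_const (vert u) p)
  have := fderiv_apply_eq_of_eqOn H.isOpen hp (fun q hq => hN q hq u) hS
    (hT.const_smul Complex.I) a
  rw [smul_apply, hS', hT'] at this
  simpa only [zero_apply, map_zero, add_zero] using this

theorem spray₂_I_left (H : IsSprayOf U ℓ G) (hN : HasComplexNonlin U G) (hp : p ∈ U)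
    (a : CSpace n × CSpace n) (u : CSpace n) :
    fderiv ℝ (fderiv ℝ G) p (vert (Complex.I • u)) a
      = Complex.I • fderiv ℝ (fderiv ℝ G) p (vert u) a := by
  rw [H.spray_swap hp, H.spray₂_I hN hp, H.spray_swap hp]

/-- The Cauchy-Riemann equation for the second derivatives along the fibre: symmetry of the third
derivative carries `Complex.I` between the last slot and the first. -/
theorem spray₃_I (H : IsSprayOf U ℓ G) (hN : HasComplexNonlin U G) (hp : p ∈ U)
    (a b : CSpace n × CSpace n) (u : CSpace n) :
    fderiv ℝ (fderiv ℝ (fderiv ℝ G)) p (vert (Complex.I • u)) a b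
      = Complex.I • fderiv ℝ (fderiv ℝ (fderiv ℝ G)) p (vert u) a b := by
  obtain ⟨S, hS, hS'⟩ := hasFDerivAt_apply₂ (H.hasFDerivAt_spray₂ hp) b (vert (Complex.I • u))
  obtain ⟨T, hT, hT'⟩ := hasFDerivAt_apply₂ (H.hasFDerivAt_spray₂ hp) b (vert u)
  have := fderiv_apply_eq_of_eqOn H.isOpen hp (fun q hq => H.spray₂_I hN hq b u) hS
    (hT.const_smul Complex.I) a
  rw [smul_apply, hS', hT'] at this
  rw [H.spray₃_swap hp, H.spray₃_swap' hp, this, H.spray₃_swap' hp, H.spray₃_swap hp]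

variable {T : Set (CSpace n)}

/-- The second vertical derivatives of the spray along a line in a fibre. -/
theorem hasFDerivAt_spray₂_line {F : Type*} [NormedAddCommGroup F] [NormedSpace ℝ F]
    (H : IsSprayOf U ℓ G) {z : CSpace n} {c : F → CSpace n} {c' : F →L[ℝ] CSpace n} {t : F}
    (hc : HasFDerivAt c c' t) (hp : (z, c t) ∈ U) (s w : CSpace n) :
    ∃ S : F →L[ℝ] CSpace n,
      HasFDerivAt (fun t => fderiv ℝ (fderiv ℝ G) (z, c t) (vert s) (vert w)) S t ∧
      ∀ r, S r = fderiv ℝ (fderiv ℝ (fderiv ℝ G)) (z, c t) (vert (c' r)) (vert s) (vert w) := by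
  obtain ⟨S, hS, hS'⟩ := hasFDerivAt_apply₂ (H.hasFDerivAt_spray₂ hp) (vert s) (vert w)
  have hz : HasFDerivAt (fun t => (z, c t)) ((0 : F →L[ℝ] CSpace n).prod c') t :=
    (hasFDerivAt_const z t).prodMk hc
  refine ⟨_, HasFDerivAt.comp t (f := fun t => (z, c t)) hS hz, fun r => ?_⟩
  rw [ContinuousLinearMap.comp_apply, hS']
  rfl

theorem spray₂_smul (H : IsSprayOf (slitOver T) ℓ G) {z v : CSpace n} (hz : z ∈ T) (hv : v ≠ 0)
    {c : ℝ} (hc : 0 < c) (s w : CSpace n) :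
    fderiv ℝ (fderiv ℝ G) (z, c • v) (vert s) (vert w)
      = fderiv ℝ (fderiv ℝ G) (z, v) (vert s) (vert w) := by
  have key : ∀ x ∈ Set.Ioi (0 : ℝ), HasDerivAt
      (fun x : ℝ => fderiv ℝ (fderiv ℝ G) (z, x • v) (vert s) (vert w)) 0 x := by
    intro x hx
    have hx' : x ≠ 0 := ne_of_gt hx
    have hp : (z, x • v) ∈ slitOver T := ⟨hz, smul_ne_zero hx' hv⟩
    obtain ⟨S, hS, hS'⟩ := H.hasFDerivAt_spray₂_line (c := fun x : ℝ => x • v)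
      ((hasDerivAt_id x).smul_const v).hasFDerivAt hp s w
    have h3 := H.spray₃_radial hp s w
    have h4 : S 1 = 0 := by
      rw [hS']
      have : vert ((z, x • v) : CSpace n × CSpace n).2 = x • vert v := map_smul vert x v
      rw [this, map_smul, smul_apply, smul_apply] at h3
      simpa using (smul_eq_zero.1 h3).resolve_left hx'
    simpa [h4] using hS.hasDerivAt
  have := isOpen_Ioi.is_const_of_deriv_eq_zero isPreconnected_Ioi
    (fun x hx => (key x hx).differentiableAt.differentiableWithinAt)
    (fun x hx => (key x hx).deriv) (Set.mem_Ioi.2 hc) (Set.mem_Ioi.2 one_pos)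
  simpa using this

/-- By degree-zero homogeneity all values are attained on the unit sphere, which is compact and
avoids the singular point `v = 0`. -/
theorem spray₂_bounded (H : IsSprayOf (slitOver T) ℓ G) {z : CSpace n} (hz : z ∈ T)
    (s w : CSpace n) : ∃ C : ℝ, ∀ v : CSpace n, v ≠ 0 →
      ‖fderiv ℝ (fderiv ℝ G) (z, v) (vert s) (vert w)‖ ≤ C := by
  have hcont : ContinuousOn (fun v => fderiv ℝ (fderiv ℝ G) (z, v) (vert s) (vert w))
      (Metric.sphere (0 : CSpace n) 1) := by
    intro v hv
    have hv0 : v ≠ 0 := by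
      rintro rfl
      simp at hv
    obtain ⟨S, hS, -⟩ := H.hasFDerivAt_spray₂_line (z := z) (c := id) (hasFDerivAt_id v)
      (show (z, id v) ∈ slitOver T from ⟨hz, hv0⟩) s w
    exact hS.continuousAt.continuousWithinAt
  obtain ⟨C, hC⟩ := (isCompact_sphere (0 : CSpace n) 1).exists_bound_of_continuousOn hcont
  refine ⟨C, fun v hv => ?_⟩
  have hv' : 0 < ‖v‖⁻¹ := inv_pos.2 (norm_pos_iff.2 hv)
  rw [← H.spray₂_smul hz hv hv' s w]
  refine hC _ ?_
  rw [mem_sphere_zero_iff_norm, norm_smul, norm_inv, norm_norm,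
    inv_mul_cancel₀ (norm_ne_zero_iff.2 hv)]

/-- Along a complex line that avoids the origin of the fibre, the second vertical derivatives of a
holomorphic spray are bounded entire functions, hence constant. -/
theorem spray₂_line (H : IsSprayOf (slitOver T) ℓ G) (hN : HasComplexNonlin (slitOver T) G)
    {z a b : CSpace n} (hz : z ∈ T) (hab : ∀ t : ℂ, a + t • b ≠ 0) (s w : CSpace n) :
    fderiv ℝ (fderiv ℝ G) (z, a) (vert s) (vert w)
      = fderiv ℝ (fderiv ℝ G) (z, a + b) (vert s) (vert w) := by
  have hd : Differentiable ℂ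
      (fun t : ℂ => fderiv ℝ (fderiv ℝ G) (z, a + t • b) (vert s) (vert w)) := by
    intro t
    have hp : (z, a + t • b) ∈ slitOver T := ⟨hz, hab t⟩
    have hc : HasFDerivAt (fun t : ℂ => a + t • b)
        ((1 : ℂ →L[ℝ] ℂ).smulRight b) t :=
      ((hasFDerivAt_id (𝕜 := ℝ) t).smul_const b).const_add a
    obtain ⟨S, hS, hS'⟩ := H.hasFDerivAt_spray₂_line hc hp s w
    -- The real derivative in `t` commutes with `Complex.I`, so it is complex linear and the
    -- function is complex differentiable.
    have hSI : ∀ r : ℂ, S r = r • S 1 := by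
      intro r
      have h1 : S Complex.I = Complex.I • S 1 := by
        rw [hS', hS']
        simp only [ContinuousLinearMap.smulRight_apply, one_apply_eq_self, one_smul]
        exact H.spray₃_I hN hp _ _ b
      have h2 : r = r.re • (1 : ℂ) + r.im • Complex.I := by
        simp [Complex.re_add_im]
      conv_lhs => rw [h2, map_add, map_smul, map_smul, h1]
      conv_rhs => rw [h2, add_smul, smul_assoc, smul_assoc, one_smul]
    refine (hasFDerivAt_of_restrictScalars ℝ
      (f' := (1 : ℂ →L[ℂ] ℂ).smulRight (S 1)) hS ?_).differentiableAt
    ext r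
    simp [hSI r]
  obtain ⟨C, hC⟩ := H.spray₂_bounded hz s w
  have hb : Bornology.IsBounded (Set.range
      (fun t : ℂ => fderiv ℝ (fderiv ℝ G) (z, a + t • b) (vert s) (vert w))) := by
    rw [isBounded_iff_forall_norm_le]
    refine ⟨C, ?_⟩
    rintro _ ⟨t, rfl⟩
    exact hC _ (hab t)
  have := hd.apply_eq_apply_of_bounded hb 0 1
  simpa using this

/-- In dimension at least two, the second vertical derivatives of a holomorphic spray depend only
on the base point. -/
theorem spray₂_const (hn : 2 ≤ n) (H : IsSprayOf (slitOver T) ℓ G)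
    (hN : HasComplexNonlin (slitOver T) G) {z a b : CSpace n} (hz : z ∈ T) (ha : a ≠ 0)
    (hb : b ≠ 0) (s w : CSpace n) :
    fderiv ℝ (fderiv ℝ G) (z, a) (vert s) (vert w)
      = fderiv ℝ (fderiv ℝ G) (z, b) (vert s) (vert w) := by
  -- The complex line through two independent vectors avoids the origin.
  have indep : ∀ a b : CSpace n, a ≠ 0 → b ∉ Submodule.span ℂ {a} →
      fderiv ℝ (fderiv ℝ G) (z, a) (vert s) (vert w)
        = fderiv ℝ (fderiv ℝ G) (z, b) (vert s) (vert w) := by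
    intro a b ha hb
    have := H.spray₂_line hN (a := a) (b := b - a) hz (fun t ht => ?_) s w
    · simpa using this
    · rw [smul_sub] at ht
      have h1 : t • b = (t - 1) • a := by
        rw [sub_smul, one_smul]
        rw [← sub_eq_zero, ← ht]
        abel
      by_cases h0 : t = 0
      · subst h0
        simp at ht
        exact ha ht
      · refine hb (Submodule.mem_span_singleton.2 ⟨t⁻¹ * (t - 1), ?_⟩)
        rw [mul_smul, ← h1, smul_smul, inv_mul_cancel₀ h0, one_smul]
  by_cases hab : b ∈ Submodule.span ℂ {a}
  -- The line through two proportional vectors may hit the origin. The comparison passes through a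
  -- third vector off their common span, which exists because `2 ≤ n`.
  · obtain ⟨c, hc⟩ : ∃ c : CSpace n, c ∉ Submodule.span ℂ {a} := by
      by_contra! hcon
      have h1 : Submodule.span ℂ {a} = ⊤ := Submodule.eq_top_iff'.2 hcon
      have h2 := finrank_span_singleton (K := ℂ) ha
      rw [h1, finrank_top, finrank_euclideanSpace, Fintype.card_fin] at h2
      omega
    have hc' : c ∉ Submodule.span ℂ {b} := fun h =>
      hc ((Submodule.span_singleton_le_iff_mem _ _).2 hab h)
    rw [indep a c ha hc, indep b c hb hc']
  · exact indep a b ha hab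

theorem spray₃_eq_zero (hn : 2 ≤ n) (H : IsSprayOf (slitOver T) ℓ G)
    (hN : HasComplexNonlin (slitOver T) G) (hp : p ∈ slitOver T) (r s w : CSpace n) :
    fderiv ℝ (fderiv ℝ (fderiv ℝ G)) p (vert r) (vert s) (vert w) = 0 := by
  obtain ⟨z, v⟩ := p
  obtain ⟨S, hS, hS'⟩ := H.hasFDerivAt_spray₂_line (c := id) (hasFDerivAt_id v) hp s w
  have h0 : (fun v => fderiv ℝ (fderiv ℝ G) (z, id v) (vert s) (vert w)) =ᶠ[nhds v]
      fun _ => fderiv ℝ (fderiv ℝ G) (z, v) (vert s) (vert w) := by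
    filter_upwards [isOpen_ne.mem_nhds hp.2] with v' hv'
    exact H.spray₂_const hn hN hp.1 hv' hp.2 s w
  have := hS.unique ((hasFDerivAt_const _ _).congr_of_eventuallyEq h0)
  have h1 := hS' r
  rw [this] at h1
  exact h1.symm

/-! ### The horizontal derivatives of the fundamental tensor of a Berwald metric -/

theorem hasFDerivAt_hlift (H : IsSprayOf U ℓ G) (hp : p ∈ U) (u : CSpace n) :
    ∃ S : CSpace n × CSpace n →L[ℝ] CSpace n × CSpace n, HasFDerivAt (fun q => hlift G q u) S p ∧
      ∀ s, S s = -vert (fderiv ℝ (fderiv ℝ G) p s (vert u)) := by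
  obtain ⟨T, hT, hT'⟩ := hasFDerivAt_clm_apply₁ (H.hasFDerivAt_spray₁ hp)
    (hasFDerivAt_const (vert u) p)
  refine ⟨_, ((vert (E := CSpace n)).hasFDerivAt.comp p hT).const_sub (base u), fun s => ?_⟩
  rw [neg_apply, ContinuousLinearMap.comp_apply, hT', zero_apply, map_zero, add_zero]

/-- Vertical derivative of `energy_horizontal`; the right-hand side comes from differentiating the
horizontal lift. -/
theorem energy_horizontal₁ (H : IsSprayOf U ℓ G) (hp : p ∈ U) (w u : CSpace n) :
    fderiv ℝ (fderiv ℝ ℓ) p (vert w) (hlift G p u)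
      = fderiv ℝ ℓ p (vert (fderiv ℝ (fderiv ℝ G) p (vert w) (vert u))) := by
  obtain ⟨S, hS, hS'⟩ := H.hasFDerivAt_hlift hp u
  obtain ⟨R, hR, hR'⟩ := hasFDerivAt_clm_apply₁ (H.hasFDerivAt₁ hp) hS
  have := fderiv_apply_eq_of_eqOn H.isOpen hp (fun q hq => H.energy_horizontal hq u) hR
    (hasFDerivAt_const 0 p) (vert w)
  rw [hR', hS', map_neg, zero_apply] at this
  exact add_neg_eq_zero.1 this

theorem hasFDerivAt_vert_spray₂ (H : IsSprayOf U ℓ G) (hQ : IsQuadratic U G) (hp : p ∈ U)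
    (w u : CSpace n) : ∃ S : CSpace n × CSpace n →L[ℝ] CSpace n × CSpace n,
      HasFDerivAt (fun q => vert (fderiv ℝ (fderiv ℝ G) q (vert w) (vert u))) S p ∧
      ∀ r : CSpace n, S (vert r) = 0 := by
  obtain ⟨T, hT, hT'⟩ := hasFDerivAt_apply₂ (H.hasFDerivAt_spray₂ hp) (vert w) (vert u)
  refine ⟨_, (vert (E := CSpace n)).hasFDerivAt.comp p hT, fun r => ?_⟩
  rw [ContinuousLinearMap.comp_apply, hT', hQ p hp, map_zero]

theorem metric_horizontal (H : IsSprayOf U ℓ G) (hQ : IsQuadratic U G) (hp : p ∈ U)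
    (t w u : CSpace n) :
    fderiv ℝ (fderiv ℝ (fderiv ℝ ℓ)) p (hlift G p u) (vert t) (vert w)
      = fderiv ℝ (fderiv ℝ ℓ) p (vert (fderiv ℝ (fderiv ℝ G) p (vert t) (vert u))) (vert w)
      + fderiv ℝ (fderiv ℝ ℓ) p (vert t) (vert (fderiv ℝ (fderiv ℝ G) p (vert w) (vert u))) := by
  obtain ⟨S, hS, hS'⟩ := H.hasFDerivAt_hlift hp u
  obtain ⟨R, hR, hR'⟩ := hasFDerivAt_clm_apply₂ (H.hasFDerivAt₂ hp)
    (hasFDerivAt_const (vert w) p) hS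
  obtain ⟨Q, hq, hq'⟩ := H.hasFDerivAt_vert_spray₂ hQ hp w u
  obtain ⟨P, hP, hP'⟩ := hasFDerivAt_clm_apply₁ (H.hasFDerivAt₁ hp) hq
  have := fderiv_apply_eq_of_eqOn H.isOpen hp (fun q hq => H.energy_horizontal₁ hq w u) hR hP
    (vert t)
  rw [hR', hP', hS', hq', map_neg, map_zero, zero_apply, map_zero] at this
  simp only [zero_apply, add_zero] at this
  rw [H.swap₃ hp, H.swap₃' hp, H.swap₂ hp (vert _) (vert w), ← this]
  ring

/-- One more vertical derivative of `metric_horizontal`: the Cartan tensor, up to the factor `F`, is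
parallel in every horizontal direction. -/
theorem cartan_horizontal (H : IsSprayOf U ℓ G) (hQ : IsQuadratic U G) (hp : p ∈ U)
    (s t w u : CSpace n) :
    fderiv ℝ (fderiv ℝ (fderiv ℝ (fderiv ℝ ℓ))) p (hlift G p u) (vert s) (vert t) (vert w)
      = fderiv ℝ (fderiv ℝ (fderiv ℝ ℓ)) p
          (vert (fderiv ℝ (fderiv ℝ G) p (vert s) (vert u))) (vert t) (vert w)
      + fderiv ℝ (fderiv ℝ (fderiv ℝ ℓ)) p (vert s)
          (vert (fderiv ℝ (fderiv ℝ G) p (vert t) (vert u))) (vert w)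
      + fderiv ℝ (fderiv ℝ (fderiv ℝ ℓ)) p (vert s) (vert t)
          (vert (fderiv ℝ (fderiv ℝ G) p (vert w) (vert u))) := by
  obtain ⟨S, hS, hS'⟩ := H.hasFDerivAt_hlift hp u
  have hR := ((H.hasFDerivAt₃ hp).clm_apply hS).clm_apply (hasFDerivAt_const (vert t) p)
    |>.clm_apply (hasFDerivAt_const (vert w) p)
  obtain ⟨Q, hq, hq'⟩ := H.hasFDerivAt_vert_spray₂ hQ hp w u
  obtain ⟨Q₁, hq₁, hq₁'⟩ := H.hasFDerivAt_vert_spray₂ hQ hp t u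
  obtain ⟨P, hP, hP'⟩ := hasFDerivAt_clm_apply₂ (H.hasFDerivAt₂ hp) hq₁
    (hasFDerivAt_const (vert w) p)
  obtain ⟨P₁, hP₁, hP₁'⟩ := hasFDerivAt_clm_apply₂ (H.hasFDerivAt₂ hp)
    (hasFDerivAt_const (vert t) p) hq
  have := fderiv_apply_eq_of_eqOn H.isOpen hp (fun q hq => H.metric_horizontal hQ hq t w u) hR
    (hP.add hP₁) (vert s)
  rw [add_apply P P₁, hP', hP₁', hq', hq₁'] at this
  simp only [add_apply, ContinuousLinearMap.comp_apply, ContinuousLinearMap.flip_apply,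
    zero_apply, map_zero, add_zero, zero_add, hS', map_neg, neg_apply] at this
  rw [H.swap₄ hp, add_assoc, ← this]
  ring

end IsSprayOf

end Holomorphic

/-! ### From index formulas to coordinate-free identities; the real conclusions (b) and (c). -/

section Coordinates

set_option maxSynthPendingDepth 10

variable {n : ℕ}

/-- The real coordinates as continuous linear forms. -/
def rcoordL (j : RIdx n) : CSpace n →L[ℝ] ℝ :=
  LinearMap.toContinuousLinearMap
    { toFun := fun w => rcoord w j
      map_add' := fun a b => by cases j <;> simp [rcoord]
      map_smul' := fun c a => by cases j <;> simp [rcoord] }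

theorem rcoordL_apply (j : RIdx n) (w : CSpace n) : rcoordL j w = rcoord w j := rfl

theorem rcoord_rvec (j k : RIdx n) : rcoord (rvec j : CSpace n) k = if k = j then 1 else 0 := by
  rcases j with j | j <;> rcases k with k | k <;> by_cases h : k = j <;> simp [rcoord, rvec, h]

theorem rcoord_sum_smul_rvec (c : RIdx n → ℝ) (k : RIdx n) :
    rcoord (∑ j, c j • (rvec j : CSpace n)) k = c k := by
  rw [← rcoordL_apply, map_sum]
  simp [rcoordL_apply, rcoord_rvec]

theorem sum_rcoord_smul_rvec (w : CSpace n) : ∑ j, rcoord w j • rvec j = w := by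
  ext α
  simp only [Fintype.sum_sum_type, rcoord, rvec, PiLp.add_apply, WithLp.ofLp_sum, Finset.sum_apply,
    PiLp.smul_apply, PiLp.single_apply]
  simp [Complex.re_add_im]

variable {W : Type*} [NormedAddCommGroup W] [NormedSpace ℝ W]

theorem clm_apply_eq_sum (Φ : CSpace n →L[ℝ] W) (w : CSpace n) :
    Φ w = ∑ j, rcoord w j • Φ (rvec j) := by
  conv_lhs => rw [← sum_rcoord_smul_rvec w, map_sum]
  simp only [map_smul]

theorem clm_ext_rvec {Φ Ψ : CSpace n →L[ℝ] W} (h : ∀ j, Φ (rvec j) = Ψ (rvec j)) : Φ = Ψ := by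
  ext w
  rw [clm_apply_eq_sum Φ, clm_apply_eq_sum Ψ]
  simp only [h]

section

variable {V ι : Type*} [NormedAddCommGroup V] [NormedSpace ℝ V] [Fintype ι] [DecidableEq ι]
  {U : Set V} {M : V → Matrix ι ι ℝ}

theorem contDiffOn_det (hM : ∀ i j, ContDiffOn ℝ ∞ (fun q => M q i j) U) :
    ContDiffOn ℝ ∞ (fun q => (M q).det) U := by
  simp only [Matrix.det_apply]
  exact ContDiffOn.sum fun σ _ => (contDiffOn_prod fun i _ => hM _ _).const_smul _

theorem contDiffOn_matrix_inv (hM : ∀ i j, ContDiffOn ℝ ∞ (fun q => M q i j) U)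
    (hdet : ∀ q ∈ U, (M q).det ≠ 0) (i j : ι) : ContDiffOn ℝ ∞ (fun q => (M q)⁻¹ i j) U := by
  simp only [Matrix.inv_def, Matrix.smul_apply, smul_eq_mul, Ring.inverse_eq_inv',
    Matrix.adjugate_apply]
  refine ((contDiffOn_det hM).inv hdet).mul (contDiffOn_det fun a b => ?_)
  -- In the determinant giving an adjugate entry, row `j` is a constant basis vector and the other
  -- rows are those of `M`.
  by_cases h : a = j
  · subst h
    simpa using contDiffOn_const
  · simpa [Matrix.updateRow_apply, h] using hM a b

end

/-- The energy function of `f`. -/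
def energy (f : CSpace n × CSpace n → ℝ) (q : CSpace n × CSpace n) : ℝ := f q ^ 2

/-- The spray as a vector of the fibre. -/
def sprayVec (f : CSpace n × CSpace n → ℝ) (p : CSpace n × CSpace n) : CSpace n :=
  ∑ k, spray f k p • rvec k

/-- The vector `Γ̂^k_{j;l} ∂/∂y^k`. -/
def cartanVec (f : CSpace n × CSpace n → ℝ) (j l : RIdx n)
    (p : CSpace n × CSpace n) : CSpace n :=
  ∑ k, cartanHor f k j l p • rvec k

/-- The horizontal lift as a linear map. -/
def hliftL (G : CSpace n × CSpace n → CSpace n) (p : CSpace n × CSpace n) :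
    CSpace n →L[ℝ] CSpace n × CSpace n :=
  base - (vert.comp (fderiv ℝ G p)).comp vert

theorem hliftL_apply (G : CSpace n × CSpace n → CSpace n)
    (p : CSpace n × CSpace n) (u : CSpace n) : hliftL G p u = hlift G p u := rfl

/-- The linear map `w ↦ w^j Γ̂^k_{j;l} ∂/∂y^k`. -/
def cartanEnd (f : CSpace n × CSpace n → ℝ) (l : RIdx n)
    (p : CSpace n × CSpace n) (w : CSpace n) : CSpace n :=
  ∑ j, rcoord w j • cartanVec f j l p

/-- `f` is the expression in coordinates, over the open set `T`, of a strongly convex metric. -/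
structure IsLocalMetric (T : Set (CSpace n)) (f : CSpace n × CSpace n → ℝ) : Prop where
  isOpen : IsOpen T
  smooth : ContDiffOn ℝ ∞ f (slitOver T)
  homogeneous : ∀ z ∈ T, ∀ (v : CSpace n) (c : ℝ), f (z, c • v) = |c| * f (z, v)
  convex : ∀ p ∈ slitOver T, (fundTensor f p).PosDef

namespace IsLocalMetric

variable {T : Set (CSpace n)} {f : CSpace n × CSpace n → ℝ} {p : CSpace n × CSpace n}

theorem isOpen_slitOver (H : IsLocalMetric T f) : IsOpen (slitOver T) :=
  (H.isOpen.preimage continuous_fst).inter (isOpen_ne.preimage continuous_snd)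

theorem smooth_energy (H : IsLocalMetric T f) : ContDiffOn ℝ ∞ (energy f) (slitOver T) :=
  H.smooth.pow 2

theorem fundTensor_apply (H : IsLocalMetric T f) (hp : p ∈ slitOver T) (j k : RIdx n) :
    fundTensor f p j k
      = 1 / 2 * fderiv ℝ (fderiv ℝ (energy f)) p (vert (rvec j)) (vert (rvec k)) := by
  rw [← fderiv_fderiv_apply H.isOpen_slitOver H.smooth_energy hp]
  rfl

theorem smooth_fundTensor (H : IsLocalMetric T f) (j k : RIdx n) :
    ContDiffOn ℝ ∞ (fun q => fundTensor f q j k) (slitOver T) := by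
  have h2 := contDiffOn_fderiv H.isOpen_slitOver
    (contDiffOn_fderiv H.isOpen_slitOver H.smooth_energy)
  exact (contDiffOn_const.mul ((h2.clm_apply (contDiffOn_const (c := vert (rvec j)))).clm_apply
    (contDiffOn_const (c := vert (rvec k))))).congr fun q hq => H.fundTensor_apply hq j k

theorem smooth_inv_fundTensor (H : IsLocalMetric T f) (j k : RIdx n) :
    ContDiffOn ℝ ∞ (fun q => (fundTensor f q)⁻¹ j k) (slitOver T) :=
  contDiffOn_matrix_inv H.smooth_fundTensor (fun q hq => (H.convex q hq).det_pos.ne') j k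

theorem energy_swap (H : IsLocalMetric T f) (hp : p ∈ slitOver T) (a b : CSpace n × CSpace n) :
    fderiv ℝ (fderiv ℝ (energy f)) p a b = fderiv ℝ (fderiv ℝ (energy f)) p b a :=
  fderiv_fderiv_swap H.isOpen_slitOver H.smooth_energy hp a b

/-- Raising the index of the linear form `κ` with the fundamental tensor. -/
theorem sharp_apply (H : IsLocalMetric T f) (hp : p ∈ slitOver T) (κ : CSpace n →L[ℝ] ℝ)
    (t : CSpace n) :
    1 / 2 * fderiv ℝ (fderiv ℝ (energy f)) p
      (vert (∑ k, (∑ s, (fundTensor f p)⁻¹ k s * κ (rvec s)) • rvec k)) (vert t) = κ t := by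
  set a : CSpace n := ∑ k, (∑ s, (fundTensor f p)⁻¹ k s * κ (rvec s)) • rvec k with ha
  have key : ((1 / 2 : ℝ) • fderiv ℝ (fderiv ℝ (energy f)) p (vert a)).comp vert = κ := by
    refine clm_ext_rvec fun j => ?_
    have h1 : fundTensor f p * (fundTensor f p)⁻¹ = 1 :=
      Matrix.mul_nonsing_inv _ (H.convex p hp).det_pos.ne'.isUnit
    calc ((1 / 2 : ℝ) • fderiv ℝ (fderiv ℝ (energy f)) p (vert a)).comp vert (rvec j)
        = ∑ k, (∑ s, (fundTensor f p)⁻¹ k s * κ (rvec s)) * fundTensor f p j k := by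
          simp only [ContinuousLinearMap.comp_apply, smul_apply, ha, map_sum, map_smul, sum_apply,
            smul_eq_mul, Finset.mul_sum]
          refine Finset.sum_congr rfl fun k _ => ?_
          rw [H.fundTensor_apply hp, H.energy_swap hp (vert (rvec k))]
          ring
      _ = ∑ s, (fundTensor f p * (fundTensor f p)⁻¹) j s * κ (rvec s) := by
          simp only [Matrix.mul_apply, Finset.sum_mul]
          rw [Finset.sum_comm]
          refine Finset.sum_congr rfl fun s _ => Finset.sum_congr rfl fun k _ => ?_
          ring
      _ = κ (rvec j) := by
          rw [h1]
          simp [Matrix.one_apply]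
  rw [← key]
  simp

theorem spray_apply (H : IsLocalMetric T f) (hp : p ∈ slitOver T) (k : RIdx n) :
    spray f k p = ∑ s, (fundTensor f p)⁻¹ k s *
      (1 / 4 * (fderiv ℝ (fderiv ℝ (energy f)) p (base p.2) (vert (rvec s))
        - fderiv ℝ (energy f) p (base (rvec s)))) := by
  rw [spray, Finset.mul_sum]
  refine Finset.sum_congr rfl fun s _ => ?_
  have h1 : ∑ a, dX a (dY s (fun q => f q ^ 2)) p * rcoord p.2 a
      = fderiv ℝ (fderiv ℝ (energy f)) p (base p.2) (vert (rvec s)) := by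
    have := clm_apply_eq_sum
      (((fderiv ℝ (fderiv ℝ (energy f)) p).flip (vert (rvec s))).comp base) p.2
    simp only [ContinuousLinearMap.comp_apply, ContinuousLinearMap.flip_apply] at this
    rw [this]
    refine Finset.sum_congr rfl fun a _ => ?_
    rw [← fderiv_fderiv_apply H.isOpen_slitOver H.smooth_energy hp, smul_eq_mul, mul_comm]
    rfl
  rw [h1]
  change _ * (_ * (_ - fderiv ℝ (energy f) p (base (rvec s)))) = _
  ring

theorem smooth_spray (H : IsLocalMetric T f) (k : RIdx n) :
    ContDiffOn ℝ ∞ (spray f k) (slitOver T) := by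
  have h1 := contDiffOn_fderiv H.isOpen_slitOver H.smooth_energy
  have h2 := contDiffOn_fderiv H.isOpen_slitOver h1
  refine (ContDiffOn.sum fun s _ => (H.smooth_inv_fundTensor k s).mul
    (contDiffOn_const.mul (((h2.clm_apply ?_).clm_apply
      (contDiffOn_const (c := vert (rvec s)))).sub
      (h1.clm_apply (contDiffOn_const (c := base (rvec s))))))).congr
    fun q hq => H.spray_apply hq k
  exact ((base (E := CSpace n)).contDiff.comp contDiff_snd).contDiffOn

theorem energy_euler (H : IsLocalMetric T f) (hp : p ∈ slitOver T) :
    fderiv ℝ (energy f) p (vert p.2) = 2 * energy f p := by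
  obtain ⟨z, v⟩ := p
  have h1 : HasDerivAt (fun c : ℝ => ((z, c • v) : CSpace n × CSpace n)) (vert v) 1 := by
    simpa using (hasDerivAt_const (1 : ℝ) z).prodMk ((hasDerivAt_id (1 : ℝ)).smul_const v)
  have h2 : HasFDerivAt (energy f) (fderiv ℝ (energy f) (z, v)) (z, (1 : ℝ) • v) := by
    rw [one_smul]
    exact hasFDerivAt_of_contDiffOn H.isOpen_slitOver H.smooth_energy hp
  have h3 := h2.comp_hasDerivAt (1 : ℝ) h1
  have h4 : HasDerivAt (fun c : ℝ => c ^ 2 * energy f (z, v)) (2 * energy f (z, v)) 1 := by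
    simpa using (hasDerivAt_pow 2 (1 : ℝ)).mul_const (energy f (z, v))
  refine h3.unique (h4.congr_of_eventuallyEq (Filter.Eventually.of_forall fun c => ?_))
  simp only [Function.comp_apply, energy, H.homogeneous z hp.1, mul_pow, sq_abs]

theorem isSprayOf (H : IsLocalMetric T f) : IsSprayOf (slitOver T) (energy f) (sprayVec f) where
  isOpen := H.isOpen_slitOver
  smooth := H.smooth_energy
  smooth_spray := ContDiffOn.sum fun k _ => (H.smooth_spray k).smul contDiffOn_const
  euler := fun p hp => H.energy_euler hp
  convex := by
    intro p hp u hu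
    have hx : rcoord u ≠ 0 := fun h0 => hu <| by
      rw [← sum_rcoord_smul_rvec u, h0]
      simp
    have h1 := (H.convex p hp).dotProduct_mulVec_pos hx
    have h2 : star (rcoord u) ⬝ᵥ (fundTensor f p).mulVec (rcoord u)
        = 1 / 2 * fderiv ℝ (fderiv ℝ (energy f)) p (vert u) (vert u) := by
      have e1 := clm_apply_eq_sum
        (((fderiv ℝ (fderiv ℝ (energy f)) p).flip (vert u)).comp vert) u
      simp only [ContinuousLinearMap.comp_apply, ContinuousLinearMap.flip_apply] at e1
      rw [e1, Finset.mul_sum]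
      refine Finset.sum_congr rfl fun j _ => ?_
      have e2 := clm_apply_eq_sum
        ((fderiv ℝ (fderiv ℝ (energy f)) p (vert (rvec j))).comp vert) u
      simp only [ContinuousLinearMap.comp_apply] at e2
      rw [e2, Matrix.mulVec, dotProduct, smul_eq_mul, Finset.mul_sum, Finset.mul_sum,
        Finset.mul_sum]
      refine Finset.sum_congr rfl fun k _ => ?_
      rw [H.fundTensor_apply hp, smul_eq_mul, Pi.star_apply, star_trivial]
      ring
    rw [h2] at h1
    linarith
  spray_eq := by
    intro p hp t
    have h1 := H.sharp_apply hp ((1 / 4 : ℝ) • ((fderiv ℝ (fderiv ℝ (energy f)) p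
      (base p.2)).comp vert - (fderiv ℝ (energy f) p).comp base)) t
    have h2 : sprayVec f p = ∑ k, (∑ s, (fundTensor f p)⁻¹ k s *
        ((1 / 4 : ℝ) • ((fderiv ℝ (fderiv ℝ (energy f)) p
          (base p.2)).comp vert - (fderiv ℝ (energy f) p).comp base)) (rvec s)) • rvec k := by
      refine Finset.sum_congr rfl fun k _ => ?_
      rw [H.spray_apply hp]
      rfl
    rw [← h2] at h1
    simp only [smul_apply, sub_apply, ContinuousLinearMap.comp_apply, smul_eq_mul] at h1
    linarith

theorem spray_eq_rcoord (f : CSpace n × CSpace n → ℝ) (k : RIdx n) :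
    spray f k = fun q => rcoordL k (sprayVec f q) := by
  ext q
  rw [rcoordL_apply, sprayVec, rcoord_sum_smul_rvec]

theorem dY_spray (H : IsLocalMetric T f) (hp : p ∈ slitOver T) (k j : RIdx n) :
    dY j (spray f k) p = rcoord (fderiv ℝ (sprayVec f) p (vert (rvec j))) k := by
  have h := (rcoordL k).hasFDerivAt.comp p (H.isSprayOf.hasFDerivAt_spray hp)
  rw [dY, spray_eq_rcoord]
  exact congrArg (fun L : CSpace n × CSpace n →L[ℝ] ℝ => L (vert (rvec j))) h.fderiv

theorem horizVec_eq (H : IsLocalMetric T f) (hp : p ∈ slitOver T) (j : RIdx n) :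
    horizVec f j p = hlift (sprayVec f) p (rvec j) := by
  have : ∑ k, nonlin f k j p • rvec k = fderiv ℝ (sprayVec f) p (vert (rvec j)) := by
    simp only [nonlin, H.dY_spray hp]
    exact sum_rcoord_smul_rvec _
  rw [horizVec, this, hlift]
  simp

theorem berwaldCoeff_eq (H : IsLocalMetric T f) (hp : p ∈ slitOver T) (k j l : RIdx n) :
    berwaldCoeff f k j l p
      = rcoord (fderiv ℝ (fderiv ℝ (sprayVec f)) p (vert (rvec j)) (vert (rvec l))) k := by
  obtain ⟨S, hS, hS'⟩ := hasFDerivAt_clm_apply₁ (H.isSprayOf.hasFDerivAt_spray₁ hp)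
    (hasFDerivAt_const (vert (rvec l)) p)
  have h := (rcoordL k).hasFDerivAt.comp p hS
  have he : dY l (spray f k) =ᶠ[nhds p]
      fun q => rcoordL k (fderiv ℝ (sprayVec f) q (vert (rvec l))) :=
    Filter.eventually_of_mem (H.isOpen_slitOver.mem_nhds hp) fun q hq => H.dY_spray hq k l
  rw [berwaldCoeff, dY, (h.congr_of_eventuallyEq he).fderiv]
  change rcoordL k (S (vert (rvec j))) = _
  rw [hS']
  simp [rcoordL_apply]

theorem deltaX_fundTensor (H : IsLocalMetric T f) (hp : p ∈ slitOver T) (l j k : RIdx n) :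
    deltaX f l (fun q => fundTensor f q j k) p
      = 1 / 2 * fderiv ℝ (fderiv ℝ (fderiv ℝ (energy f))) p (hlift (sprayVec f) p (rvec l))
        (vert (rvec j)) (vert (rvec k)) := by
  obtain ⟨S, hS, hS'⟩ := IsSprayOf.hasFDerivAt_apply₂ (H.isSprayOf.hasFDerivAt₂ hp)
    (vert (rvec j)) (vert (rvec k))
  have he : (fun q => fundTensor f q j k) =ᶠ[nhds p] fun q => 1 / 2 *
      fderiv ℝ (fderiv ℝ (energy f)) q (vert (rvec j)) (vert (rvec k)) :=
    Filter.eventually_of_mem (H.isOpen_slitOver.mem_nhds hp) fun q hq => H.fundTensor_apply hq j k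
  rw [deltaX, ((hS.const_mul (1 / 2)).congr_of_eventuallyEq he).fderiv, H.horizVec_eq hp,
    smul_apply, hS', smul_eq_mul]

theorem cartanVec_koszul (H : IsLocalMetric T f) (hp : p ∈ slitOver T) (j l : RIdx n)
    (t : CSpace n) :
    2 * fderiv ℝ (fderiv ℝ (energy f)) p (vert (cartanVec f j l p)) (vert t)
      = fderiv ℝ (fderiv ℝ (fderiv ℝ (energy f))) p (hlift (sprayVec f) p (rvec l))
          (vert t) (vert (rvec j))
        - fderiv ℝ (fderiv ℝ (fderiv ℝ (energy f))) p (hlift (sprayVec f) p t)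
          (vert (rvec j)) (vert (rvec l))
        + fderiv ℝ (fderiv ℝ (fderiv ℝ (energy f))) p (hlift (sprayVec f) p (rvec j))
          (vert (rvec l)) (vert t) := by
  set D := fderiv ℝ (fderiv ℝ (fderiv ℝ (energy f))) p with hD
  let κ : CSpace n →L[ℝ] ℝ := (1 / 4 : ℝ) •
    (((D (hliftL (sprayVec f) p (rvec l))).flip (vert (rvec j))).comp vert
      - ((D.flip (vert (rvec j))).flip (vert (rvec l))).comp (hliftL (sprayVec f) p)
      + (D (hliftL (sprayVec f) p (rvec j)) (vert (rvec l))).comp vert)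
  have h1 := H.sharp_apply hp κ t
  have h2 : cartanVec f j l p
      = ∑ k, (∑ s, (fundTensor f p)⁻¹ k s * κ (rvec s)) • rvec k := by
    refine Finset.sum_congr rfl fun k _ => ?_
    congr 1
    refine Finset.sum_congr rfl fun s _ => ?_
    rw [H.deltaX_fundTensor hp, H.deltaX_fundTensor hp, H.deltaX_fundTensor hp]
    simp only [κ, smul_apply, add_apply, sub_apply, ContinuousLinearMap.comp_apply,
      ContinuousLinearMap.flip_apply, hliftL_apply, smul_eq_mul, ← hD]
    ring
  rw [← h2] at h1
  simp only [κ, smul_apply, add_apply, sub_apply, ContinuousLinearMap.comp_apply,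
    ContinuousLinearMap.flip_apply, hliftL_apply, smul_eq_mul] at h1
  linarith

theorem cartanEnd_koszul (H : IsLocalMetric T f) (hp : p ∈ slitOver T) (l : RIdx n)
    (u t : CSpace n) :
    2 * fderiv ℝ (fderiv ℝ (energy f)) p (vert (cartanEnd f l p u)) (vert t)
      = fderiv ℝ (fderiv ℝ (fderiv ℝ (energy f))) p (hlift (sprayVec f) p (rvec l))
          (vert t) (vert u)
        - fderiv ℝ (fderiv ℝ (fderiv ℝ (energy f))) p (hlift (sprayVec f) p t)
          (vert u) (vert (rvec l))
        + fderiv ℝ (fderiv ℝ (fderiv ℝ (energy f))) p (hlift (sprayVec f) p u)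
          (vert (rvec l)) (vert t) := by
  set D := fderiv ℝ (fderiv ℝ (fderiv ℝ (energy f))) p with hD
  have h1 := clm_apply_eq_sum ((D (hliftL (sprayVec f) p (rvec l)) (vert t)).comp vert
      - ((D (hliftL (sprayVec f) p t)).flip (vert (rvec l))).comp vert
      + ((D.flip (vert (rvec l))).flip (vert t)).comp (hliftL (sprayVec f) p)) u
  simp only [add_apply, sub_apply, ContinuousLinearMap.comp_apply,
    ContinuousLinearMap.flip_apply, hliftL_apply, smul_eq_mul] at h1
  rw [h1, cartanEnd, map_sum, map_sum, sum_apply, Finset.mul_sum]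
  refine Finset.sum_congr rfl fun j _ => ?_
  rw [map_smul, map_smul, smul_apply, smul_eq_mul, ← H.cartanVec_koszul hp]
  ring

/-- The classical `Γ̂^k_{j;l} y^l = Γ̂^k_j`, through which the hypothesis on the Cartan connection
reaches the spray. It is the Koszul formula with the radial vector in the slot `l`. -/
theorem nonlin_eq_sum_cartanEnd (H : IsLocalMetric T f) (hp : p ∈ slitOver T) (u : CSpace n) :
    fderiv ℝ (sprayVec f) p (vert u) = ∑ l, rcoord p.2 l • cartanEnd f l p u := by
  refine H.isSprayOf.vert_eq_of_forall hp fun t => ?_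
  have h0 := H.isSprayOf.koszul_radial hp u t
  set D := fderiv ℝ (fderiv ℝ (fderiv ℝ (energy f))) p with hD
  have h1 := clm_apply_eq_sum (((D.flip (vert t)).flip (vert u)).comp (hliftL (sprayVec f) p)
      - (D (hliftL (sprayVec f) p t) (vert u)).comp vert
      + ((D (hliftL (sprayVec f) p u)).flip (vert t)).comp vert) p.2
  simp only [add_apply, sub_apply, ContinuousLinearMap.comp_apply,
    ContinuousLinearMap.flip_apply, hliftL_apply, smul_eq_mul] at h1
  rw [h1] at h0
  have h2 : (2 : ℝ) * fderiv ℝ (fderiv ℝ (energy f)) p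
      (vert (∑ l, rcoord p.2 l • cartanEnd f l p u)) (vert t)
      = 2 * fderiv ℝ (fderiv ℝ (energy f)) p (vert (fderiv ℝ (sprayVec f) p (vert u))) (vert t) := by
    rw [← h0, map_sum, map_sum, sum_apply, Finset.mul_sum]
    refine Finset.sum_congr rfl fun j _ => ?_
    rw [map_smul, map_smul, smul_apply, smul_eq_mul, ← H.cartanEnd_koszul hp]
    ring
  linarith

/-- As for the Levi-Civita connection, a symmetric metric-compatible connection is the one given by
the Koszul formula. -/
theorem cartanVec_eq (H : IsLocalMetric T f) (hQ : IsQuadratic (slitOver T) (sprayVec f))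
    (hp : p ∈ slitOver T) (j l : RIdx n) :
    cartanVec f j l p
      = fderiv ℝ (fderiv ℝ (sprayVec f)) p (vert (rvec j)) (vert (rvec l)) := by
  have S := H.isSprayOf
  refine S.vert_eq_of_forall hp fun t => ?_
  have h0 := H.cartanVec_koszul hp j l t
  rw [S.metric_horizontal hQ hp, S.metric_horizontal hQ hp, S.metric_horizontal hQ hp,
    S.spray_swap hp (vert (rvec j)) (vert t), S.spray_swap hp (vert (rvec l)) (vert t),
    S.spray_swap hp (vert (rvec l)) (vert (rvec j)), S.swap₂ hp (vert t) (vert _),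
    S.swap₂ hp (vert (rvec j)) (vert _), S.swap₂ hp (vert (rvec l)) (vert _)] at h0
  linarith

theorem cartanHor_eq_rcoord (f : CSpace n × CSpace n → ℝ) (k j l : RIdx n)
    (p : CSpace n × CSpace n) : cartanHor f k j l p = rcoord (cartanVec f j l p) k := by
  rw [cartanVec, rcoord_sum_smul_rvec]

theorem cartanHor_eq_berwaldCoeff (H : IsLocalMetric T f)
    (hQ : IsQuadratic (slitOver T) (sprayVec f))
    (hp : p ∈ slitOver T) (k j l : RIdx n) : cartanHor f k j l p = berwaldCoeff f k j l p := by
  rw [cartanHor_eq_rcoord, H.cartanVec_eq hQ hp, H.berwaldCoeff_eq hp]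

/-! ### The Landsberg tensor -/

theorem dY_dY_dY_energy (H : IsLocalMetric T f) (hp : p ∈ slitOver T) (j k l : RIdx n) :
    dY j (dY k (dY l (fun q => f q ^ 2))) p = fderiv ℝ (fderiv ℝ (fderiv ℝ (energy f))) p
      (vert (rvec j)) (vert (rvec k)) (vert (rvec l)) := by
  obtain ⟨S, hS, hS'⟩ := IsSprayOf.hasFDerivAt_apply₂ (H.isSprayOf.hasFDerivAt₂ hp)
    (vert (rvec k)) (vert (rvec l))
  have he : dY k (dY l (fun q => f q ^ 2)) =ᶠ[nhds p] fun q =>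
      fderiv ℝ (fderiv ℝ (energy f)) q (vert (rvec k)) (vert (rvec l)) :=
    Filter.eventually_of_mem (H.isOpen_slitOver.mem_nhds hp) fun q hq =>
      fderiv_fderiv_apply H.isOpen_slitOver H.smooth_energy hq _ _
  rw [dY, (hS.congr_of_eventuallyEq he).fderiv]
  exact hS' _

/-- Euler's relations give `D²ℓ(v, v) = 2ℓ` for the vertical Hessian, which convexity makes
positive. -/
theorem energy_ne_zero (H : IsLocalMetric T f) (hp : p ∈ slitOver T) : f p ≠ 0 := by
  have S := H.isSprayOf
  have h1 := S.convex p hp p.2 hp.2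
  have h2 := S.euler₂ hp (vert p.2)
  rw [vert_snd, S.euler p hp, energy] at h2
  intro h0
  rw [h0] at h2
  linarith

theorem fderiv_horizontal (H : IsLocalMetric T f) (hp : p ∈ slitOver T) (u : CSpace n) :
    fderiv ℝ f p (hlift (sprayVec f) p u) = 0 := by
  have h1 := (hasFDerivAt_of_contDiffOn H.isOpen_slitOver H.smooth hp).pow 2
  have h2 : fderiv ℝ (energy f) p = _ := h1.fderiv
  have h3 := H.isSprayOf.energy_horizontal hp u
  rw [h2] at h3
  simpa [H.energy_ne_zero hp] using h3

theorem cartanTensor_apply (H : IsLocalMetric T f) (hp : p ∈ slitOver T) (j k l : RIdx n) :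
    cartanTensor f j k l p = f p / 4 * fderiv ℝ (fderiv ℝ (fderiv ℝ (energy f))) p
      (vert (rvec j)) (vert (rvec k)) (vert (rvec l)) := by
  rw [cartanTensor, H.dY_dY_dY_energy hp]

theorem deltaX_cartanTensor (H : IsLocalMetric T f) (hp : p ∈ slitOver T) (s j k l : RIdx n) :
    deltaX f s (cartanTensor f j k l) p
      = f p / 4 * fderiv ℝ (fderiv ℝ (fderiv ℝ (fderiv ℝ (energy f)))) p
        (hlift (sprayVec f) p (rvec s)) (vert (rvec j)) (vert (rvec k)) (vert (rvec l)) := by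
  have hR := (((H.isSprayOf.hasFDerivAt₃ hp).clm_apply
    (hasFDerivAt_const (vert (rvec j)) p)).clm_apply
    (hasFDerivAt_const (vert (rvec k)) p)).clm_apply (hasFDerivAt_const (vert (rvec l)) p)
  have hf := hasFDerivAt_of_contDiffOn H.isOpen_slitOver H.smooth hp
  have he : cartanTensor f j k l =ᶠ[nhds p] fun q => f q *
      (1 / 4 * fderiv ℝ (fderiv ℝ (fderiv ℝ (energy f))) q
        (vert (rvec j)) (vert (rvec k)) (vert (rvec l))) :=
    Filter.eventually_of_mem (H.isOpen_slitOver.mem_nhds hp) fun q hq => by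
      simp only [H.cartanTensor_apply hq]
      ring
  rw [deltaX, ((hf.mul (hR.const_mul (1 / 4))).congr_of_eventuallyEq he).fderiv, H.horizVec_eq hp]
  simp only [add_apply, smul_apply, H.fderiv_horizontal hp, ContinuousLinearMap.comp_apply,
    ContinuousLinearMap.flip_apply, zero_apply, map_zero, smul_eq_mul, mul_zero, add_zero,
    zero_add]
  ring

/-- Each summand vanishes before contraction with `y^s`: the Cartan coefficients are those of `B`,
for which the Cartan tensor is parallel, and the factor `F` is constant along horizontal vectors. -/
theorem landsbergTensor_eq_zero (H : IsLocalMetric T f)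
    (hQ : IsQuadratic (slitOver T) (sprayVec f))
    (hp : p ∈ slitOver T) (j k l : RIdx n) : landsbergTensor f j k l p = 0 := by
  refine Finset.sum_eq_zero fun s _ => ?_
  have key := H.isSprayOf.cartan_horizontal hQ hp (rvec j) (rvec k) (rvec l) (rvec s)
  rw [← H.cartanVec_eq hQ hp, ← H.cartanVec_eq hQ hp, ← H.cartanVec_eq hQ hp] at key
  have h0 : deltaX f s (cartanTensor f j k l) p
      - ∑ a, (cartanHor f a j s p * cartanTensor f a k l p
      + cartanHor f a k s p * cartanTensor f j a l p
      + cartanHor f a l s p * cartanTensor f j k a p) = 0 := by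
    rw [H.deltaX_cartanTensor hp, key]
    simp only [cartanVec, map_sum, map_smul, sum_apply, smul_apply, H.cartanTensor_apply hp,
      smul_eq_mul]
    rw [← Finset.sum_add_distrib, ← Finset.sum_add_distrib, Finset.mul_sum,
      ← Finset.sum_sub_distrib]
    refine Finset.sum_eq_zero fun a _ => ?_
    ring
  rw [h0, zero_mul]

end IsLocalMetric

end Coordinates

/-! ### Sesquilinear parts, the Chern-Finsler connection, and the use of the hypothesis on `𝐉`. -/

section Hermitian

set_option maxSynthPendingDepth 10

variable {n : ℕ}

theorem rvec_inr (α : Fin n) :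
    (rvec (Sum.inr α) : CSpace n) = Complex.I • rvec (Sum.inl α) := by
  ext β
  simp [rvec]

theorem I_smul_I_smul (u : CSpace n) : Complex.I • Complex.I • u = -u := by
  rw [smul_smul, Complex.I_mul_I, neg_one_smul]

theorem sum_smul_rvec_inl (u : CSpace n) : ∑ ν, u ν • rvec (Sum.inl ν) = u := by
  ext α
  simp [rvec, Pi.single_apply]

theorem smul_eq_re_add_im (c : ℂ) (u : CSpace n) : c • u = c.re • u + c.im • Complex.I • u := by
  conv_lhs => rw [← Complex.re_add_im c, add_smul, mul_smul]
  rfl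

/-- A map that is real linear and commutes with the complex structure, in complex coordinates. -/
theorem apply_eq_sum_of_I (Φ : CSpace n →L[ℝ] ℂ) (hΦ : ∀ u, Φ (Complex.I • u) = Complex.I * Φ u)
    (u : CSpace n) : Φ u = ∑ ν, u ν * Φ (rvec (Sum.inl ν)) := by
  conv_lhs => rw [← sum_smul_rvec_inl u, map_sum]
  refine Finset.sum_congr rfl fun ν _ => ?_
  rw [smul_eq_re_add_im, map_add, map_smul, map_smul, hΦ]
  conv_rhs => rw [← Complex.re_add_im (u ν)]
  simp only [Complex.real_smul]
  ring

/-- The complex linear part of a real linear form, in complex coordinates. -/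
theorem linear_part_eq_sum (Θ : CSpace n →L[ℝ] ℂ) (u : CSpace n) :
    (Θ u - Complex.I * Θ (Complex.I • u)) / 2
      = ∑ ν, u ν * ((Θ (rvec (Sum.inl ν)) - Complex.I * Θ (rvec (Sum.inr ν))) / 2) := by
  let J : CSpace n →L[ℝ] CSpace n :=
    (Complex.I • ContinuousLinearMap.id ℂ (CSpace n)).restrictScalars ℝ
  have hJ : ∀ u, J u = Complex.I • u := fun u => rfl
  have := apply_eq_sum_of_I ((1 / 2 : ℂ) • (Θ - Complex.I • Θ.comp J)) (fun u => by
    simp only [smul_apply, sub_apply, ContinuousLinearMap.comp_apply, hJ, I_smul_I_smul, map_neg,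
      smul_eq_mul]
    linear_combination (1 / 2 * Θ (Complex.I • u)) * Complex.I_mul_I) u
  simp only [smul_apply, sub_apply, ContinuousLinearMap.comp_apply, hJ, smul_eq_mul,
    ← rvec_inr] at this
  rw [div_eq_inv_mul, ← one_div, this]
  refine Finset.sum_congr rfl fun ν _ => ?_
  ring

/-- The sesquilinear part of a real bilinear form. -/
def sesq (b : CSpace n →L[ℝ] CSpace n →L[ℝ] ℝ) (u w : CSpace n) : ℂ :=
  ((b u w : ℂ) + Complex.I * b u (Complex.I • w) - Complex.I * b (Complex.I • u) w
    + b (Complex.I • u) (Complex.I • w)) / 4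

theorem sesq_conj (b : CSpace n →L[ℝ] CSpace n →L[ℝ] ℝ) (u w : CSpace n) :
    star (sesq b w u) = sesq b.flip u w := by
  simp [sesq, Complex.conj_ofReal]
  ring

theorem sesq_eq_sum_left (b : CSpace n →L[ℝ] CSpace n →L[ℝ] ℝ) (u w : CSpace n) :
    sesq b u w = ∑ ν, u ν * sesq b (rvec (Sum.inl ν)) w := by
  have := linear_part_eq_sum ((1 / 2 : ℂ) • (Complex.ofRealCLM.comp (b.flip w)
    + Complex.I • Complex.ofRealCLM.comp (b.flip (Complex.I • w)))) u
  simp only [smul_apply, add_apply, ContinuousLinearMap.comp_apply,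
    ContinuousLinearMap.flip_apply, Complex.ofRealCLM_apply, smul_eq_mul, rvec_inr] at this
  calc sesq b u w = _ := ?_
    _ = _ := this
    _ = _ := Finset.sum_congr rfl fun ν _ => ?_
  · rw [sesq]
    linear_combination (1 / 4 * (b (Complex.I • u) (Complex.I • w) : ℂ)) * Complex.I_mul_I
  · rw [sesq]
    linear_combination (-1 / 4 * u ν * (b (Complex.I • rvec (Sum.inl ν)) (Complex.I • w) : ℂ))
      * Complex.I_mul_I

theorem sesq_eq_sum_right (b : CSpace n →L[ℝ] CSpace n →L[ℝ] ℝ) (u w : CSpace n) :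
    sesq b u w = ∑ ν, star (w ν) * sesq b u (rvec (Sum.inl ν)) := by
  rw [← b.flip_flip, ← sesq_conj, sesq_eq_sum_left, star_sum]
  refine Finset.sum_congr rfl fun ν _ => ?_
  rw [star_mul', sesq_conj]

theorem sesq_self_re (b : CSpace n →L[ℝ] CSpace n →L[ℝ] ℝ) (u : CSpace n) :
    (sesq b u u).re = (b u u + b (Complex.I • u) (Complex.I • u)) / 4 := by
  have h : sesq b u u = (((b u u + b (Complex.I • u) (Complex.I • u)) / 4 : ℝ) : ℂ)
      + ((b u (Complex.I • u) - b (Complex.I • u) u) / 4 : ℝ) * Complex.I := by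
    rw [sesq]
    push_cast
    ring
  rw [h]
  simp

/-- A null vector `u` would give `sesq b u u = 0`, whereas its real part is the average of two
positive numbers, up to a factor. -/
theorem det_sesq_ne_zero {b : CSpace n →L[ℝ] CSpace n →L[ℝ] ℝ} (hb : ∀ u, u ≠ 0 → 0 < b u u)
    {M : Matrix (Fin n) (Fin n) ℂ}
    (hM : ∀ α β, M α β = sesq b (rvec (Sum.inl α)) (rvec (Sum.inl β))) : M.det ≠ 0 := by
  intro h0
  obtain ⟨x, hx, hxM⟩ := Matrix.exists_vecMul_eq_zero_iff.2 h0
  set u : CSpace n := WithLp.toLp 2 x with hu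
  have hu0 : u ≠ 0 := fun h => hx (by
    ext α
    exact congrArg (fun v : CSpace n => v α) h)
  have h1 : ∀ τ, sesq b u (rvec (Sum.inl τ)) = 0 := by
    intro τ
    have h := congrFun hxM τ
    simp only [Matrix.vecMul, dotProduct, hM] at h
    rw [sesq_eq_sum_left]
    exact h
  have h2 : sesq b u u = 0 := by
    rw [sesq_eq_sum_right]
    simp [h1]
  have h3 := sesq_self_re b u
  rw [h2, Complex.zero_re] at h3
  linarith [hb u hu0, hb (Complex.I • u) (smul_ne_zero Complex.I_ne_zero hu0)]

/-- Raising an index with the inverse of `M`. -/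
theorem sum_inv_mul_sum {M : Matrix (Fin n) (Fin n) ℂ} (hM : M.det ≠ 0) (m : CSpace n)
    (α : Fin n) : ∑ τ, M⁻¹ τ α * ∑ ν, m ν * M ν τ = m α := by
  have h1 : M * M⁻¹ = 1 := Matrix.mul_nonsing_inv _ hM.isUnit
  calc ∑ τ, M⁻¹ τ α * ∑ ν, m ν * M ν τ = ∑ ν, m ν * (M * M⁻¹) ν α := by
        simp only [Matrix.mul_apply, Finset.mul_sum]
        rw [Finset.sum_comm]
        refine Finset.sum_congr rfl fun s _ => Finset.sum_congr rfl fun k _ => ?_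
        ring
    _ = m α := by
        rw [h1]
        simp [Matrix.one_apply]

theorem hasFDerivAt_sesq {D : CSpace n × CSpace n →
      CSpace n × CSpace n →L[ℝ] CSpace n × CSpace n →L[ℝ] ℝ}
    {D' : CSpace n × CSpace n →L[ℝ] CSpace n × CSpace n →L[ℝ] CSpace n × CSpace n →L[ℝ] ℝ}
    {p : CSpace n × CSpace n} (hD : HasFDerivAt D D' p) (u w : CSpace n) :
    ∃ T : CSpace n × CSpace n →L[ℝ] ℂ,
      HasFDerivAt (fun q => sesq ((D q).bilinearComp vert vert) u w) T p ∧
      ∀ s, T s = sesq ((D' s).bilinearComp vert vert) u w := by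
  have key : ∀ a b : CSpace n × CSpace n, ∃ T : CSpace n × CSpace n →L[ℝ] ℂ,
      HasFDerivAt (fun q => (D q a b : ℂ)) T p ∧ ∀ s, T s = D' s a b := by
    intro a b
    obtain ⟨S, hS, hS'⟩ := IsSprayOf.hasFDerivAt_apply₂ hD a b
    refine ⟨_, Complex.ofRealCLM.hasFDerivAt.comp p hS, fun s => ?_⟩
    rw [ContinuousLinearMap.comp_apply, hS', Complex.ofRealCLM_apply]
  obtain ⟨A, hA, hA'⟩ := key (vert u) (vert w)
  obtain ⟨B, hB, hB'⟩ := key (vert u) (vert (Complex.I • w))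
  obtain ⟨C, hC, hC'⟩ := key (vert (Complex.I • u)) (vert w)
  obtain ⟨R, hR, hR'⟩ := key (vert (Complex.I • u)) (vert (Complex.I • w))
  refine ⟨(1 / 4 : ℂ) • (A + Complex.I • B - Complex.I • C + R), ?_, fun s => ?_⟩
  · have := (((hA.add (hB.const_mul Complex.I)).sub (hC.const_mul Complex.I)).add hR).const_mul
      (1 / 4 : ℂ)
    refine this.congr_of_eventuallyEq (Filter.Eventually.of_forall fun q => ?_)
    simp only [sesq, ContinuousLinearMap.bilinearComp_apply, Pi.add_apply, Pi.sub_apply]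
    ring
  · simp only [smul_apply, add_apply, sub_apply, hA', hB', hC', hR', sesq, smul_eq_mul,
      ContinuousLinearMap.bilinearComp_apply]
    ring

namespace IsLocalMetric

variable {T : Set (CSpace n)} {f : CSpace n × CSpace n → ℝ} {p : CSpace n × CSpace n}

theorem dVbar_energy (H : IsLocalMetric T f) (hp : p ∈ slitOver T) (β : Fin n) :
    dVbar β (fun q => ((f q ^ 2 : ℝ) : ℂ)) p
      = (fderiv ℝ (energy f) p (vert (rvec (Sum.inl β)))
        + Complex.I * fderiv ℝ (energy f) p (vert (rvec (Sum.inr β)))) / 2 := by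
  have h := Complex.ofRealCLM.hasFDerivAt.comp p
    (hasFDerivAt_of_contDiffOn H.isOpen_slitOver H.smooth_energy hp)
  have h1 : fderiv ℝ (fun q => ((f q ^ 2 : ℝ) : ℂ)) p = _ := h.fderiv
  rw [dVbar, dY, dY, h1]
  rfl

theorem fderiv_dVbar_energy (H : IsLocalMetric T f) (hp : p ∈ slitOver T) (β : Fin n)
    (s : CSpace n × CSpace n) :
    fderiv ℝ (dVbar β (fun q => ((f q ^ 2 : ℝ) : ℂ))) p s
      = (fderiv ℝ (fderiv ℝ (energy f)) p s (vert (rvec (Sum.inl β)))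
        + Complex.I * fderiv ℝ (fderiv ℝ (energy f)) p s
          (vert (Complex.I • rvec (Sum.inl β)))) / 2 := by
  have key : ∀ a : CSpace n × CSpace n, HasFDerivAt (fun q => (fderiv ℝ (energy f) q a : ℂ))
      (Complex.ofRealCLM.comp ((fderiv ℝ (fderiv ℝ (energy f)) p).flip a)) p := by
    intro a
    refine Complex.ofRealCLM.hasFDerivAt.comp p ?_
    simpa using (H.isSprayOf.hasFDerivAt₁ hp).clm_apply (hasFDerivAt_const a p)
  have he : dVbar β (fun q => ((f q ^ 2 : ℝ) : ℂ)) =ᶠ[nhds p] fun q => (1 / 2 : ℂ) *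
      (fderiv ℝ (energy f) q (vert (rvec (Sum.inl β)))
        + Complex.I * fderiv ℝ (energy f) q (vert (rvec (Sum.inr β)))) :=
    Filter.eventually_of_mem (H.isOpen_slitOver.mem_nhds hp) fun q hq => by
      simp only [H.dVbar_energy hq]
      ring
  have h := ((key (vert (rvec (Sum.inl β)))).add
    ((key (vert (rvec (Sum.inr β)))).const_mul Complex.I)).const_mul (1 / 2 : ℂ)
  rw [(h.congr_of_eventuallyEq he).fderiv, ← rvec_inr]
  simp only [smul_apply, add_apply, ContinuousLinearMap.comp_apply,
    ContinuousLinearMap.flip_apply, Complex.ofRealCLM_apply, smul_eq_mul]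
  ring

theorem cFundTensor_apply (H : IsLocalMetric T f) (hp : p ∈ slitOver T) (α β : Fin n) :
    cFundTensor f p α β = sesq ((fderiv ℝ (fderiv ℝ (energy f)) p).bilinearComp vert vert)
      (rvec (Sum.inl α)) (rvec (Sum.inl β)) := by
  rw [cFundTensor, dV, dY, dY]
  erw [H.fderiv_dVbar_energy hp β (vert (rvec (Sum.inl α))),
    H.fderiv_dVbar_energy hp β (vert (rvec (Sum.inr α)))]
  rw [rvec_inr]
  simp only [sesq, ContinuousLinearMap.bilinearComp_apply]
  linear_combination (-1 / 4 * (fderiv ℝ (fderiv ℝ (energy f)) p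
    (vert (Complex.I • rvec (Sum.inl α))) (vert (Complex.I • rvec (Sum.inl β))) : ℂ))
    * Complex.I_mul_I

theorem dZ_dVbar_energy (H : IsLocalMetric T f) (hp : p ∈ slitOver T) (α β : Fin n) :
    dZ α (dVbar β (fun q => ((f q ^ 2 : ℝ) : ℂ))) p
      = sesq ((fderiv ℝ (fderiv ℝ (energy f)) p).bilinearComp base vert)
      (rvec (Sum.inl α)) (rvec (Sum.inl β)) := by
  rw [dZ, dX, dX]
  erw [H.fderiv_dVbar_energy hp β (base (rvec (Sum.inl α))),
    H.fderiv_dVbar_energy hp β (base (rvec (Sum.inr α)))]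
  rw [rvec_inr]
  simp only [sesq, ContinuousLinearMap.bilinearComp_apply]
  linear_combination (-1 / 4 * (fderiv ℝ (fderiv ℝ (energy f)) p
    (base (Complex.I • rvec (Sum.inl α))) (vert (Complex.I • rvec (Sum.inl β))) : ℂ))
    * Complex.I_mul_I

theorem det_cFundTensor_ne_zero (H : IsLocalMetric T f) (hp : p ∈ slitOver T) :
    (cFundTensor f p).det ≠ 0 :=
  det_sesq_ne_zero (fun u hu => H.isSprayOf.convex p hp u hu) (H.cFundTensor_apply hp)

/-- Splitting `base u` into its horizontal lift and `vert (N u)` leaves the correction `Dℓ(B(w,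
u))`. It is the real part of a complex bilinear form, so its sesquilinear part is zero. -/
theorem sesq_base_vert (H : IsLocalMetric T f)
    (hN : HasComplexNonlin (slitOver T) (sprayVec f)) (hp : p ∈ slitOver T) (u w : CSpace n) :
    sesq ((fderiv ℝ (fderiv ℝ (energy f)) p).bilinearComp base vert) u w
      = sesq ((fderiv ℝ (fderiv ℝ (energy f)) p).bilinearComp vert vert)
        (fderiv ℝ (sprayVec f) p (vert u)) w := by
  have S := H.isSprayOf
  have key : ∀ u w : CSpace n, fderiv ℝ (fderiv ℝ (energy f)) p (base u) (vert w)
      = fderiv ℝ (fderiv ℝ (energy f)) p (vert (fderiv ℝ (sprayVec f) p (vert u))) (vert w)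
        + fderiv ℝ (energy f) p
          (vert (fderiv ℝ (fderiv ℝ (sprayVec f)) p (vert w) (vert u))) := by
    intro u w
    rw [← S.energy_horizontal₁ hp w u, S.swap₂ hp (vert w), hlift, map_sub, sub_apply]
    ring
  simp only [sesq, ContinuousLinearMap.bilinearComp_apply, key, hN p hp,
    S.spray₂_I hN hp, S.spray₂_I_left hN hp, I_smul_I_smul, map_neg]
  push_cast
  ring

theorem cNonlin_eq (H : IsLocalMetric T f)
    (hN : HasComplexNonlin (slitOver T) (sprayVec f)) (hp : p ∈ slitOver T) (α μ : Fin n) :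
    cNonlin f α μ p = fderiv ℝ (sprayVec f) p (vert (rvec (Sum.inl μ))) α := by
  rw [← sum_inv_mul_sum (H.det_cFundTensor_ne_zero hp) _ α, cNonlin]
  refine Finset.sum_congr rfl fun τ _ => ?_
  rw [H.dZ_dVbar_energy hp, H.sesq_base_vert hN hp, sesq_eq_sum_left]
  simp only [H.cFundTensor_apply hp]

theorem fderiv_cFundTensor (H : IsLocalMetric T f) (hp : p ∈ slitOver T) (β τ : Fin n)
    (s : CSpace n × CSpace n) :
    fderiv ℝ (fun q => cFundTensor f q β τ) p s
      = sesq ((fderiv ℝ (fderiv ℝ (fderiv ℝ (energy f))) p s).bilinearComp vert vert)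
        (rvec (Sum.inl β)) (rvec (Sum.inl τ)) := by
  obtain ⟨S, hS, hS'⟩ := hasFDerivAt_sesq (H.isSprayOf.hasFDerivAt₂ hp)
    (rvec (Sum.inl β)) (rvec (Sum.inl τ))
  have he : (fun q => cFundTensor f q β τ) =ᶠ[nhds p] fun q =>
      sesq ((fderiv ℝ (fderiv ℝ (energy f)) q).bilinearComp vert vert)
        (rvec (Sum.inl β)) (rvec (Sum.inl τ)) :=
    Filter.eventually_of_mem (H.isOpen_slitOver.mem_nhds hp) fun q hq =>
      H.cFundTensor_apply hq β τ
  rw [(hS.congr_of_eventuallyEq he).fderiv, hS']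

/-- Since `Γ^ν_{;μ}` are the complex components of the complex linear map `N`, the field `δ_μ` is
the `(1,0)` part of the real horizontal lift. -/
theorem deltaZ_eq (H : IsLocalMetric T f)
    (hN : HasComplexNonlin (slitOver T) (sprayVec f)) (hp : p ∈ slitOver T) (μ : Fin n)
    (h : CSpace n × CSpace n → ℂ) :
    deltaZ f μ h p = (fderiv ℝ h p (hlift (sprayVec f) p (rvec (Sum.inl μ)))
      - Complex.I * fderiv ℝ h p
        (hlift (sprayVec f) p (Complex.I • rvec (Sum.inl μ)))) / 2 := by
  have h1 := linear_part_eq_sum ((fderiv ℝ h p).comp vert)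
    (fderiv ℝ (sprayVec f) p (vert (rvec (Sum.inl μ))))
  simp only [ContinuousLinearMap.comp_apply] at h1
  have h2 : deltaZ f μ h p = (fderiv ℝ h p (base (rvec (Sum.inl μ)))
      - Complex.I * fderiv ℝ h p (base (rvec (Sum.inr μ)))) / 2
      - ∑ ν, fderiv ℝ (sprayVec f) p (vert (rvec (Sum.inl μ))) ν *
        ((fderiv ℝ h p (vert (rvec (Sum.inl ν)))
          - Complex.I * fderiv ℝ h p (vert (rvec (Sum.inr ν)))) / 2) := by
    simp only [deltaZ, H.cNonlin_eq hN hp]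
    rfl
  rw [h2, ← h1, hlift, hlift, map_sub, map_sub, hN p hp, rvec_inr]
  ring

/-- The `(1,0)` part of `metric_horizontal`. The term with `B` acting on the conjugate slot
disappears because a complex bilinear `B` has no mixed component. -/
theorem deltaZ_cFundTensor (H : IsLocalMetric T f)
    (hN : HasComplexNonlin (slitOver T) (sprayVec f))
    (hQ : IsQuadratic (slitOver T) (sprayVec f)) (hp : p ∈ slitOver T)
    (β τ μ : Fin n) :
    deltaZ f μ (fun q => cFundTensor f q β τ) p
      = sesq ((fderiv ℝ (fderiv ℝ (energy f)) p).bilinearComp vert vert)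
        (fderiv ℝ (fderiv ℝ (sprayVec f)) p (vert (rvec (Sum.inl β))) (vert (rvec (Sum.inl μ))))
        (rvec (Sum.inl τ)) := by
  have S := H.isSprayOf
  rw [H.deltaZ_eq hN hp, H.fderiv_cFundTensor hp, H.fderiv_cFundTensor hp]
  simp only [sesq, ContinuousLinearMap.bilinearComp_apply, S.metric_horizontal hQ hp,
    S.spray₂_I hN hp, S.spray₂_I_left hN hp, I_smul_I_smul, map_neg, neg_apply]
  push_cast
  ring_nf
  simp only [Complex.I_sq]
  ring

theorem chernFinslerHor_eq (H : IsLocalMetric T f)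
    (hN : HasComplexNonlin (slitOver T) (sprayVec f))
    (hQ : IsQuadratic (slitOver T) (sprayVec f)) (hp : p ∈ slitOver T)
    (α β μ : Fin n) :
    chernFinslerHor f α β μ p = fderiv ℝ (fderiv ℝ (sprayVec f)) p
      (vert (rvec (Sum.inl β))) (vert (rvec (Sum.inl μ))) α := by
  rw [← sum_inv_mul_sum (H.det_cFundTensor_ne_zero hp) _ α, chernFinslerHor]
  refine Finset.sum_congr rfl fun τ _ => ?_
  rw [H.deltaZ_cFundTensor hN hQ hp, sesq_eq_sum_left]
  simp only [H.cFundTensor_apply hp]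

theorem cartanHorC_eq (H : IsLocalMetric T f)
    (hQ : IsQuadratic (slitOver T) (sprayVec f)) (hp : p ∈ slitOver T)
    (β α γ : Fin n) :
    cartanHorC f β α γ p = fderiv ℝ (fderiv ℝ (sprayVec f)) p
      (vert (rvec (Sum.inl α))) (vert (rvec (Sum.inl γ))) β := by
  rw [cartanHorC, cartanHor_eq_rcoord, cartanHor_eq_rcoord, H.cartanVec_eq hQ hp, rcoord, rcoord,
    mul_comm, Complex.re_add_im]

/-! ### The hypothesis on the complex structure -/

/-- The forms `δy^m` annihilate horizontal vectors, so only the horizontal coefficients survive. -/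
theorem cartanForm_horizVec (f : CSpace n × CSpace n → ℝ) (p : CSpace n × CSpace n)
    (j k l : RIdx n) : cartanForm f j k p (horizVec f l p) = cartanHor f k j l p := by
  have h1 : ∀ m, deltaY f m p (horizVec f l p) = 0 := by
    intro m
    have : rcoord (-∑ k, nonlin f k l p • (rvec k : CSpace n)) m = -nonlin f m l p := by
      rw [← rcoordL_apply, map_neg, rcoordL_apply, rcoord_sum_smul_rvec]
    simp [deltaY, horizVec, this, rcoord_rvec, -Fintype.sum_sum_type]
  have h2 : (horizVec f l p).1 = rvec l := rfl
  simp [cartanForm, h1, h2, rcoord_rvec, -Fintype.sum_sum_type]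

theorem cartanEnd_eq_cartanForm (f : CSpace n × CSpace n → ℝ) (p : CSpace n × CSpace n)
    (l : RIdx n) (w : CSpace n) :
    ∑ k, (∑ j, rcoord w j * cartanForm f j k p (horizVec f l p)) • rvec k = cartanEnd f l p w := by
  simp only [cartanForm_horizVec, cartanEnd, cartanVec, Finset.smul_sum, Finset.sum_smul,
    smul_smul]
  exact Finset.sum_comm

theorem hasComplexNonlin (H : IsLocalMetric T f)
    (hJ : ∀ p ∈ slitOver T, ∀ X ∈ horizontalSpace f p,
      ∀ Y : CSpace n × CSpace n → CSpace n × CSpace n,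
        ContDiffOn ℝ ∞ Y (slitOver T) → (∀ q ∈ slitOver T, (Y q).1 = 0) →
        cartanNabla f p X (fun q => boldJ (Y q)) = boldJ (cartanNabla f p X Y)) :
    HasComplexNonlin (slitOver T) (sprayVec f) := by
  intro p hp u
  have key : ∀ l, cartanEnd f l p (Complex.I • u) = Complex.I • cartanEnd f l p u := by
    intro l
    -- For a constant vertical field the derivative terms vanish, and the hypothesis becomes purely
    -- algebraic.
    have h := hJ p hp (horizVec f l p) (Submodule.subset_span ⟨l, rfl⟩) (fun _ => (0, u))
      contDiffOn_const (fun _ _ => rfl)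
    have h2 := congrArg Prod.snd h
    simpa [cartanNabla, boldJ, cartanEnd_eq_cartanForm, -Fintype.sum_sum_type] using h2
  rw [H.nonlin_eq_sum_cartanEnd hp, H.nonlin_eq_sum_cartanEnd hp, Finset.smul_sum]
  refine Finset.sum_congr rfl fun l _ => ?_
  rw [key, smul_comm]

end IsLocalMetric

theorem IsStronglyConvexComplexFinsler.isLocalMetric {M : Type*} [TopologicalSpace M]
    [ChartedSpace (CSpace n) M] {F : TangentBundle 𝓘(ℂ, CSpace n) M → ℝ}
    (hF : IsStronglyConvexComplexFinsler F) {φ : OpenPartialHomeomorph M (CSpace n)}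
    (hφ : φ ∈ IsManifold.maximalAtlas 𝓘(ℂ, CSpace n) ω M) :
    IsLocalMetric φ.target (localExpr F φ) where
  isOpen := φ.open_target
  smooth := hF.smooth φ hφ
  homogeneous := by
    intro z _ v c
    have h1 : (c • v : CSpace n) = (c : ℂ) • v := rfl
    have h2 := hF.homogeneous (φ.symm z) (c : ℂ)
      (mfderiv 𝓘(ℂ, CSpace n) 𝓘(ℂ, CSpace n) φ.symm z v)
    rw [Complex.norm_real, Real.norm_eq_abs] at h2
    rw [localExpr, localExpr, ← h2, h1]
    congr 2
    exact map_smul (mfderiv 𝓘(ℂ, CSpace n) 𝓘(ℂ, CSpace n) φ.symm z) (c : ℂ) v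
  convex := hF.convex φ hφ

end Hermitian
end CFinsler
end

/-! ### The theorem on the manifold, chart by chart. -/

theorem mainTheorem3 {n : ℕ} (hn : 2 ≤ n) {M : Type*} [TopologicalSpace M]
    [ChartedSpace (CFinsler.CSpace n) M] [IsManifold 𝓘(ℂ, CFinsler.CSpace n) ω M]
    (F : TangentBundle 𝓘(ℂ, CFinsler.CSpace n) M → ℝ)
    (hF : CFinsler.IsStronglyConvexComplexFinsler F)
    (hJ : CFinsler.HorizontallyParallelJ F) :
    CFinsler.IsKahlerBerwald F ∧
    (∀ φ ∈ IsManifold.maximalAtlas 𝓘(ℂ, CFinsler.CSpace n) ω M, ∀ p ∈ CFinsler.slit φ,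
      ∀ α β γ : Fin n,
        CFinsler.cartanHorC (CFinsler.localExpr F φ) β α γ p
          = CFinsler.chernFinslerHor (CFinsler.localExpr F φ) β α γ p) ∧
    (∀ φ ∈ IsManifold.maximalAtlas 𝓘(ℂ, CFinsler.CSpace n) ω M, ∀ p ∈ CFinsler.slit φ,
      ∀ j k l : CFinsler.RIdx n,
        CFinsler.cartanHor (CFinsler.localExpr F φ) k j l p
          = CFinsler.berwaldCoeff (CFinsler.localExpr F φ) k j l p) ∧
    CFinsler.IsLandsberg F := by
  have hN : ∀ φ ∈ IsManifold.maximalAtlas 𝓘(ℂ, CFinsler.CSpace n) ω M,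
      CFinsler.HasComplexNonlin (CFinsler.slitOver φ.target)
        (CFinsler.sprayVec (CFinsler.localExpr F φ)) :=
    fun φ hφ => (hF.isLocalMetric hφ).hasComplexNonlin (hJ φ hφ)
  have hQ : ∀ φ ∈ IsManifold.maximalAtlas 𝓘(ℂ, CFinsler.CSpace n) ω M,
      CFinsler.IsQuadratic (CFinsler.slitOver φ.target)
        (CFinsler.sprayVec (CFinsler.localExpr F φ)) :=
    fun φ hφ p hp r s w => (hF.isLocalMetric hφ).isSprayOf.spray₃_eq_zero hn (hN φ hφ) hp r s w
  refine ⟨⟨fun φ hφ p hp α β μ => ?_, ?_⟩, fun φ hφ p hp α β γ => ?_, fun φ hφ p hp j k l => ?_,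
    fun φ hφ p hp j k l => (hF.isLocalMetric hφ).landsbergTensor_eq_zero (hQ φ hφ) hp j k l⟩
  · have H := hF.isLocalMetric hφ
    rw [H.chernFinslerHor_eq (hN φ hφ) (hQ φ hφ) hp, H.chernFinslerHor_eq (hN φ hφ) (hQ φ hφ) hp,
      H.isSprayOf.spray_swap hp]
  · rintro φ hφ ⟨z, v⟩ hp ⟨z', w⟩ hq hpq α β μ
    obtain rfl : z = z' := hpq
    have H := hF.isLocalMetric hφ
    rw [H.chernFinslerHor_eq (hN φ hφ) (hQ φ hφ) hp, H.chernFinslerHor_eq (hN φ hφ) (hQ φ hφ) hq,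
      H.isSprayOf.spray₂_const hn (hN φ hφ) hp.1 hp.2 hq.2]
  · have H := hF.isLocalMetric hφ
    rw [H.cartanHorC_eq (hQ φ hφ) hp, H.chernFinslerHor_eq (hN φ hφ) (hQ φ hφ) hp]
  · exact (hF.isLocalMetric hφ).cartanHor_eq_berwaldCoeff (hQ φ hφ) hp k j l
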